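/- For $n\ge 1$ and a partition $\lambda$ let $P_\lambda(x;\tau)$, $x=(x_1,\dots,x_n)$, be the Jack polynomial in $n$ variables with parameter $\tau=1/\alpha\in[0,\infty]$: for $0<\tau<\infty$ it is the image in $n$ variables of the Jack symmetric function, characterized by $P_\lambda(\tau)=m_\lambda+\sum_{\mu\prec\lambda}K_{\lambda\mu}(\tau)\,m_\mu$ ($\prec$ denoting strict majorization order) and $\langle P_\lambda(\tau),P_\mu(\tau)\rangle_\tau=0$ for $\lambda\ne\mu$, where $m_\mu$ are the monomial symmetric functions, $p_\rho$ the power sum products, and $\langle p_\rho,p_\pi\rangle_\tau=\delta_{\rho\pi}\,z_\rho\,\tau^{-\ell(\rho)}$ with $z_\rho=\prod_{k\ge1}k^{a_k}a_k!$ if $\rho$ has $a_k$ parts equal to $k$. At $\tau=0$ and $\tau=\infty$ the rational functions $K_{\lambda\mu}$ are replaced by their limits. For partitions $\lambda\succcurlyeq\mu$ of the same size and of length at most $n$ (where $\lambda\succcurlyeq\mu$ means that $\lambda_1+\dots+\lambda_k\ge\mu_1+\dots+\mu_k$ for all $k$), the normalized Jack difference at $\tau$ is $$D_{\lambda,\mu}(x;\tau)=\frac{P_\lambda(x;\tau)}{P_\lambda(1,\dots,1;\tau)}-\frac{P_\mu(x;\tau)}{P_\mu(1,\dots,1;\tau)}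 .$$ The Jack cone $\mathcal J^\sigma_C(\mathbb R_{\ge0})$ at parameter $\sigma\in[0,\infty]$ in $n$ variables is the set of all finite linear combinations, with coefficients in $\mathbb R_{\ge0}$, of the differences $D_{\nu,\xi}(x;\sigma)$ with $\nu\succcurlyeq\xi$ partitions of the same size and of length at most $n$. **Theorem.** Let $0\le\sigma\le\tau\le\infty$. 1. If $n=2$, then $D_{\lambda,\mu}(x;\tau)\in\mathcal J^\sigma_C(\mathbb R_{\ge0})$ for all partitions $\lambda\succcurlyeq\mu$ of the same size and of length at most $2$. 2. If $n\ge3$, $\lambda=(2,1^{n-2},0)$ and $\mu=(1^n)$, then $D_{\lambda,\mu}(x;\tau)\in\mathcal J^\sigma_C(\mathbb R_{\ge0})$. -/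

import Mathlib

open scoped NNReal ENNReal Topology

noncomputable section

namespace Jack

/-! ### Partitions and majorization -/

/-- The sum of the `k` largest parts of a partition. -/
def partialSum {d : ℕ} (lam : d.Partition) (k : ℕ) : ℕ :=
  ((lam.parts.sort (· ≥ ·)).take k).sum

/-- Majorization (dominance order) `lam ≽ mu` of partitions of the same size `d`. -/
def Majorizes {d : ℕ} (lam mu : d.Partition) : Prop :=
  ∀ k, partialSum mu k ≤ partialSum lam k

/-! ### Symmetric functions and the Hall inner product -/

/-- The algebra `Λ = ℝ[p₁, p₂, …]` of symmetric functions: a symmetric function is a polynomial in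
the power sums, and the variable `X k` is the power sum `p_k`. -/
abbrev SymFun : Type := MvPolynomial ℕ+ ℝ

/-- The image of a symmetric function in `n` variables: `p_k ↦ x₁ ^ k + ⋯ + xₙ ^ k`. -/
def toVars (n : ℕ) : SymFun →ₐ[ℝ] MvPolynomial (Fin n) ℝ :=
  MvPolynomial.aeval fun k : ℕ+ => MvPolynomial.psum (Fin n) ℝ (k : ℕ)

/-- The monomial symmetric function `m_mu` in `Λ`: the symmetric function which in any number of
variables is the monomial symmetric polynomial of `mu`. -/
def monomialFun {d : ℕ} (mu : d.Partition) : SymFun :=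
  Classical.epsilon fun f : SymFun => ∀ n, toVars n f = MvPolynomial.msymm (Fin n) ℝ mu

/-- The squared norm `z_ρ τ ^ (-ℓ(ρ))` of the power sum product `p_ρ`, where `ρ` has
`a k` parts equal to `k`; here `z_ρ = ∏ k ^ (a k) (a k)!`. -/
def hallNorm (τ : ℝ) (a : ℕ+ →₀ ℕ) : ℝ :=
  ∏ k ∈ a.support, ((k : ℕ) : ℝ) ^ a k * (Nat.factorial (a k) : ℝ) * (τ ^ a k)⁻¹

/-- The `τ`-Hall inner product: `⟨p_ρ, p_π⟩ = δ_{ρπ} z_ρ τ ^ (-ℓ(ρ))`, extended bilinearly. -/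
def hall (τ : ℝ) (f g : SymFun) : ℝ :=
  ∑ a ∈ f.support, f.coeff a * g.coeff a * hallNorm τ a

/-! ### Jack polynomials -/

/-- `K` is the list of coefficients in the monomial basis of the Jack symmetric function
`P_lam(τ) = ∑_mu K mu • m_mu`: it is `m_lam` plus terms `m_mu` with `mu` strictly below `lam` in the
majorization order, and it is orthogonal to all symmetric functions spanned by these lower terms.
See `isJackExpansion_of_family` for the comparison with pairwise orthogonality. -/
def IsJackExpansion {d : ℕ} (τ : ℝ) (lam : d.Partition) (K : d.Partition → ℝ) : Prop :=
  K lam = 1 ∧ (∀ mu, K mu ≠ 0 → Majorizes lam mu) ∧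
    ∀ mu, Majorizes lam mu → mu ≠ lam →
      hall τ (∑ nu, K nu • monomialFun nu) (monomialFun mu) = 0

/-- The coefficient `K_{lam, mu}(τ)` of `m_mu` in the Jack symmetric function `P_lam(τ)`,
for a real parameter `τ > 0`. -/
def jackCoeffReal {d : ℕ} (lam mu : d.Partition) (τ : ℝ) : ℝ :=
  Classical.epsilon (fun K : d.Partition → ℝ => IsJackExpansion τ lam K) mu

open Classical in
/-- The coefficient `K_{lam, mu}(τ)`, a rational function of `τ`, for `τ ∈ [0, ∞]`; its values
at `0` and at `∞` are the limits from inside `(0, ∞)`. -/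
def jackCoeff {d : ℕ} (lam mu : d.Partition) (τ : ℝ≥0∞) : ℝ :=
  if τ = 0 then Filter.limUnder (𝓝[>] (0 : ℝ)) (jackCoeffReal lam mu)
  else if τ = ⊤ then Filter.limUnder Filter.atTop (jackCoeffReal lam mu)
  else jackCoeffReal lam mu τ.toReal

/-- The Jack polynomial `P_lam(x₁, …, xₙ; τ)` for `τ ∈ [0, ∞]`. In terms of the parameter `α` that
is used more commonly, `τ = 1 / α`. -/
def jackPoly (n : ℕ) {d : ℕ} (lam : d.Partition) (τ : ℝ≥0∞) : MvPolynomial (Fin n) ℝ :=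
  ∑ mu : d.Partition, jackCoeff lam mu τ • MvPolynomial.msymm (Fin n) ℝ mu

/-- The normalized Jack polynomial `P_lam(x; τ) / P_lam(1, …, 1; τ)` in `n` variables. -/
def normJack (n : ℕ) {d : ℕ} (lam : d.Partition) (τ : ℝ≥0∞) : MvPolynomial (Fin n) ℝ :=
  (MvPolynomial.eval (fun _ => (1 : ℝ)) (jackPoly n lam τ))⁻¹ • jackPoly n lam τ

/-- The normalized Jack difference of the pair `lam`, `mu` at the parameter `τ`. -/
def jackDiff (n : ℕ) {d : ℕ} (lam mu : d.Partition) (τ : ℝ≥0∞) : MvPolynomial (Fin n) ℝ :=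
  normJack n lam τ - normJack n mu τ

/-- The Jack cone at the parameter `σ` in `n` variables: all finite linear combinations with
coefficients in `[0, ∞)` of the normalized Jack differences at `σ` of pairs `lam ≽ mu` of
partitions of length at most `n`. -/
def jackCone (n : ℕ) (σ : ℝ≥0∞) : Submodule ℝ≥0 (MvPolynomial (Fin n) ℝ) :=
  Submodule.span ℝ≥0 {f | ∃ (d : ℕ) (lam mu : d.Partition), lam.parts.card ≤ n ∧
    mu.parts.card ≤ n ∧ Majorizes lam mu ∧ f = jackDiff n lam mu σ}

/-! ### Comparison with pairwise orthogonal families -/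

lemma hall_add (τ : ℝ) (f g h : SymFun) : hall τ f (g + h) = hall τ f g + hall τ f h := by
  simp only [hall, MvPolynomial.coeff_add, ← Finset.sum_add_distrib]
  exact Finset.sum_congr rfl fun a _ => by ring

lemma hall_smul (τ c : ℝ) (f g : SymFun) : hall τ f (c • g) = c * hall τ f g := by
  simp only [hall, MvPolynomial.coeff_smul, Finset.mul_sum, smul_eq_mul]
  exact Finset.sum_congr rfl fun a _ => by ring

lemma hall_sum (τ : ℝ) {ι : Type*} (s : Finset ι) (f : SymFun) (g : ι → SymFun) :
    hall τ f (∑ i ∈ s, g i) = ∑ i ∈ s, hall τ f (g i) := by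
  classical
  induction s using Finset.induction_on with
  | empty => simp [hall]
  | insert i s hi ih => rw [Finset.sum_insert hi, Finset.sum_insert hi, hall_add, ih]

lemma majorizes_antisymm {d : ℕ} {lam mu : d.Partition} (h₁ : Majorizes lam mu)
    (h₂ : Majorizes mu lam) : lam = mu := by
  have hs : ∀ k, ((lam.parts.sort (· ≥ ·)).take k).sum = ((mu.parts.sort (· ≥ ·)).take k).sum :=
    fun k => le_antisymm (h₂ k) (h₁ k)
  have key : ∀ l l' : List ℕ, (∀ x ∈ l, 0 < x) → (∀ x ∈ l', 0 < x) →
      (∀ k, (l.take k).sum = (l'.take k).sum) → l = l' := by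
    intro l
    induction l with
    | nil =>
      intro l' _ hl' h
      cases l' with
      | nil => rfl
      | cons b t =>
        have h1 := h 1
        have := hl' b (by simp)
        simp at h1
        omega
    | cons a t ih =>
      intro l' hl hl' h
      cases l' with
      | nil =>
        have h1 := h 1
        have := hl a (by simp)
        simp at h1
        omega
      | cons b t' =>
        have h1 := h 1
        simp at h1
        subst h1
        congr 1
        refine ih t' (fun x hx => hl x (by simp [hx])) (fun x hx => hl' x (by simp [hx])) fun k => ?_
        simpa using h (k + 1)
  have hl := key _ _ (fun x hx => lam.parts_pos (by simpa using hx))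
    (fun x hx => mu.parts_pos (by simpa using hx)) hs
  ext1
  rw [← Multiset.sort_eq lam.parts (· ≥ ·), ← Multiset.sort_eq mu.parts (· ≥ ·), hl]

/-- If the family `P_lam = ∑_mu K lam mu • m_mu` is unitriangular with respect to majorization and
pairwise orthogonal for the `τ`-Hall inner product, then each of its rows satisfies
`IsJackExpansion`. -/
theorem isJackExpansion_of_family {d : ℕ} (τ : ℝ) (K : d.Partition → d.Partition → ℝ)
    (h1 : ∀ lam, K lam lam = 1) (htri : ∀ lam mu, K lam mu ≠ 0 → Majorizes lam mu)
    (horth : ∀ lam mu, lam ≠ mu →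
      hall τ (∑ nu, K lam nu • monomialFun nu) (∑ nu, K mu nu • monomialFun nu) = 0)
    (lam : d.Partition) : IsJackExpansion τ lam (K lam) := by
  refine ⟨h1 lam, htri lam, ?_⟩
  classical
  let r : d.Partition → d.Partition → Prop := fun nu mu => Majorizes mu nu ∧ nu ≠ mu
  have : IsTrans d.Partition r := ⟨fun a b c hab hbc => ⟨fun k => (hab.1 k).trans (hbc.1 k), by
    rintro rfl
    exact hab.2 (majorizes_antisymm hbc.1 hab.1)⟩⟩
  have : Std.Irrefl r := ⟨fun a ha => ha.2 rfl⟩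
  have wf : WellFounded r := Finite.wellFounded_of_trans_of_irrefl r
  intro mu
  induction mu using wf.induction with
  | _ mu ih =>
    intro hmu hne
    have h0 := horth lam mu (Ne.symm hne)
    rw [hall_sum, Finset.sum_eq_single mu] at h0
    · simpa [hall_smul, h1] using h0
    · intro nu _ hnu
      rw [hall_smul]
      by_cases hK : K mu nu = 0
      · simp [hK]
      · have hm := htri mu nu hK
        rw [ih nu ⟨hm, hnu⟩ (fun k => (hm k).trans (hmu k)), mul_zero]
        rintro rfl
        exact hne (majorizes_antisymm hm hmu)
    · simp

end Jack

end

noncomputable section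

namespace Jack

open MvPolynomial Finset

/-! ### The Hall inner product -/

/-! Both parts rest on explicit formulas for the Jack polynomials involved, written in θ = 1/(1+τ) ∈
[0,1], in which they stay continuous at τ = 0 and τ = ∞.

Let g_n be the coefficient of t^n in exp(τ ∑ p_k t^k/k). Multiplication by p_k is adjoint to (k/τ)
∂/∂p_k, and therefore the products of the g_n are dual to the monomial symmetric functions
(`hall_prod_gfun`). With positivity of the form this yields the existence of m_μ in Λ and the
uniqueness of Jack expansions (`IsJackExpansion.unique`), so exhibiting one expansion identifies
P_λ.

Two variables. At (z, 1/z), as a polynomial in z + 1/z, g_n is a multiple of the monic Gegenbauer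
polynomial q_n (`restrict_gfun`). Let L be a functional making the q_m orthogonal. The element of
degree d that represents f ↦ L(f(z, 1/z) q_m), m = λ₁ - λ₂, is up to a nonzero scalar the Jack
function of λ, and it restricts to a multiple of q_m (`exists_isJackExpansion`). Homogeneity then
gives P_λ(x, y). By `threeTerm_contiguity` the normalized difference of neighbours (λ₁, λ₂), (λ₁ -
1, λ₂ + 1) is a positive multiple of (xy)^λ₂ (x - y)² times a homogenized Gegenbauer polynomial of
degree m - 2 with parameter τ + 1. Gegenbauer's connection formula `threeTerm_connection` expands
the latter in those with parameter σ + 1. Besides nonnegative factors its coefficients contain a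
rising factorial of τ - σ, so they are nonnegative for σ ≤ τ. Each term is a positive multiple of a
neighbour difference at σ, and a general pair telescopes through neighbours.

Second part. Only 1^n lies strictly below (2, 1^{n-2}), so P_μ = m_μ and P_λ = m_λ + c m_μ with c ≥
0. As m_λ and m_μ have values n(n-1) and 1 at (1, …, 1), the difference equals (m_λ - n(n-1) m_μ) /
(n(n-1) + c). The differences at any two parameters are thus positive multiples of each other
(`jackDiff_low`). -/

lemma hall_eq_sum (τ : ℝ) (f g : SymFun) {s : Finset (ℕ+ →₀ ℕ)} (hs : f.support ⊆ s) :
    hall τ f g = ∑ a ∈ s, f.coeff a * g.coeff a * hallNorm τ a := by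
  refine Finset.sum_subset hs fun a _ ha => ?_
  rw [notMem_support_iff.mp ha]
  ring

lemma hall_comm (τ : ℝ) (f g : SymFun) : hall τ f g = hall τ g f := by
  classical
  rw [hall_eq_sum τ f g (s := f.support ∪ g.support) subset_union_left,
    hall_eq_sum τ g f (s := f.support ∪ g.support) subset_union_right]
  exact Finset.sum_congr rfl fun a _ => by ring

lemma hall_add_left (τ : ℝ) (f g h : SymFun) : hall τ (f + g) h = hall τ f h + hall τ g h := by
  rw [hall_comm, hall_add, hall_comm τ h f, hall_comm τ h g]

lemma hall_smul_left (τ c : ℝ) (f g : SymFun) : hall τ (c • f) g = c * hall τ f g := by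
  rw [hall_comm, hall_smul, hall_comm]

lemma hall_sum_left (τ : ℝ) {ι : Type*} (s : Finset ι) (f : SymFun) (g : ι → SymFun) :
    hall τ (∑ i ∈ s, g i) f = ∑ i ∈ s, hall τ (g i) f := by
  rw [hall_comm, hall_sum]
  exact Finset.sum_congr rfl fun _ _ => hall_comm _ _ _

lemma hall_zero (τ : ℝ) (f : SymFun) : hall τ f 0 = 0 := by
  simp [hall]

lemma hall_sub (τ : ℝ) (f g h : SymFun) : hall τ f (g - h) = hall τ f g - hall τ f h := by
  have : g - h = g + (-1 : ℝ) • h := by simp [sub_eq_add_neg]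
  rw [this, hall_add, hall_smul]
  ring

lemma hallNorm_pos {τ : ℝ} (hτ : 0 < τ) (a : ℕ+ →₀ ℕ) : 0 < hallNorm τ a := by
  refine Finset.prod_pos fun k _ => ?_
  have : (0 : ℝ) < ((k : ℕ) : ℝ) := by exact_mod_cast k.pos
  have := Nat.factorial_pos (a k)
  positivity

/-- The form is diagonal in the power sum products, with positive diagonal entries. -/
lemma hall_self_pos {τ : ℝ} (hτ : 0 < τ) {f : SymFun} (hf : f ≠ 0) : 0 < hall τ f f := by
  refine Finset.sum_pos (fun a ha => ?_) (by simpa using hf)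
  have h1 := hallNorm_pos hτ a
  have h2 : f.coeff a ≠ 0 := by simpa using ha
  exact mul_pos (mul_self_pos.mpr h2) h1

lemma eq_zero_of_hall_self {τ : ℝ} (hτ : 0 < τ) {f : SymFun} (hf : hall τ f f = 0) : f = 0 := by
  by_contra h
  exact (hall_self_pos hτ h).ne' hf

lemma hallNorm_eq_prod (τ : ℝ) (a : ℕ+ →₀ ℕ) {s : Finset ℕ+} (hs : a.support ⊆ s) :
    hallNorm τ a
      = ∏ k ∈ s, ((k : ℕ) : ℝ) ^ a k * (Nat.factorial (a k) : ℝ) * (τ ^ a k)⁻¹ := by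
  refine Finset.prod_subset hs fun k _ hk => ?_
  simp [Finsupp.notMem_support_iff.mp hk]

lemma hallNorm_add_single (τ : ℝ) (b : ℕ+ →₀ ℕ) (k : ℕ+) :
    hallNorm τ (b + Finsupp.single k 1) = hallNorm τ b * ((k : ℕ) * (b k + 1) / τ) := by
  classical
  have h1 : (b + Finsupp.single k 1).support ⊆ insert k b.support := by
    intro j hj
    by_cases h : j = k
    · simp [h]
    · simp only [Finsupp.mem_support_iff, Finsupp.add_apply, Finsupp.single_apply,
        if_neg (Ne.symm h)] at hj
      simp only [Finset.mem_insert, Finsupp.mem_support_iff]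
      right
      simpa using hj
  rw [hallNorm_eq_prod τ _ h1, hallNorm_eq_prod τ b (Finset.subset_insert k b.support),
    ← Finset.mul_prod_erase _ _ (Finset.mem_insert_self k _),
    ← Finset.mul_prod_erase (insert k b.support)
      (fun k => ((k : ℕ) : ℝ) ^ b k * (Nat.factorial (b k) : ℝ) * (τ ^ b k)⁻¹)
      (Finset.mem_insert_self k _)]
  have h2 : ∀ j ∈ (insert k b.support).erase k,
      ((j : ℕ) : ℝ) ^ ((b + Finsupp.single k 1 : ℕ+ →₀ ℕ) j) * (((b + Finsupp.single k 1 : ℕ+ →₀ ℕ) j)).factorial *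
        (τ ^ ((b + Finsupp.single k 1 : ℕ+ →₀ ℕ) j))⁻¹
        = ((j : ℕ) : ℝ) ^ b j * ((b j).factorial : ℝ) * (τ ^ b j)⁻¹ := by
    intro j hj
    have : j ≠ k := (Finset.mem_erase.mp hj).1
    simp [this]
  rw [Finset.prod_congr rfl h2]
  simp only [Finsupp.add_apply, Finsupp.single_eq_same, pow_succ, Nat.factorial_succ, mul_inv]
  push_cast
  ring

lemma hall_monomial (τ : ℝ) (a : ℕ+ →₀ ℕ) (c : ℝ) (f : SymFun) :
    hall τ (monomial a c) f = c * f.coeff a * hallNorm τ a := by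
  classical
  rw [hall_eq_sum τ _ f (support_monomial_subset), Finset.sum_singleton, coeff_monomial,
    if_pos rfl]

/-- Multiplication by the power sum `p_k` is adjoint to `(k / τ) ∂ / ∂ p_k`. -/
lemma hall_X_mul (τ : ℝ) (k : ℕ+) (f g : SymFun) :
    hall τ f (X k * g) = (k : ℕ) / τ * hall τ (pderiv k f) g := by
  induction f using MvPolynomial.induction_on' with
  | add p q hp hq => rw [hall_add_left, hp, hq, map_add, hall_add_left, mul_add]
  | monomial a c =>
    rw [pderiv_monomial, hall_monomial, hall_monomial, mul_comm (X k) g, coeff_mul_X']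
    by_cases h : k ∈ a.support
    · have h1 : a - Finsupp.single k 1 + Finsupp.single k 1 = a := by
        ext j
        have := Finsupp.mem_support_iff.mp h
        by_cases hj : j = k
        · subst hj
          simp
          omega
        · simp [hj]
      have h2 := hallNorm_add_single τ (a - Finsupp.single k 1) k
      rw [h1] at h2
      have h3 : (((a - Finsupp.single k 1 : ℕ+ →₀ ℕ) k : ℕ) : ℝ) + 1 = (a k : ℝ) := by
        have := congrArg (fun b : ℕ+ →₀ ℕ => b k) h1
        simp only [Finsupp.add_apply, Finsupp.single_eq_same] at this
        exact_mod_cast this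
      rw [if_pos h, h2, h3]
      ring
    · rw [if_neg h, Finsupp.notMem_support_iff.mp h]
      simp

end Jack

end

noncomputable section

namespace Jack

open MvPolynomial Finset

/-! ### One-row symmetric functions -/

/-- The coefficient of `t ^ n` in `exp (∑ c p_k t ^ k / k)`. -/
def gfun (c : ℝ) : ℕ → SymFun
  | 0 => 1
  | n + 1 => (c / (n + 1)) • ∑ i : Fin (n + 1), X (Nat.succPNat (n - i)) * gfun c i

@[simp] lemma gfun_zero (c : ℝ) : gfun c 0 = 1 := by
  rw [gfun]

lemma gfun_succ (c : ℝ) (n : ℕ) : gfun c (n + 1)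
    = (c / (n + 1)) • ∑ i ∈ range (n + 1), X (Nat.succPNat (n - i)) * gfun c i := by
  rw [gfun, Finset.sum_range]

/-- Logarithmic derivative of the generating series in t, free of division and so valid at n = 0 as
well. -/
lemma natCast_smul_gfun (c : ℝ) (n : ℕ) : (n : ℝ) • gfun c n
    = c • ∑ i ∈ range n, X (Nat.succPNat (n - 1 - i)) * gfun c i := by
  cases n with
  | zero => simp
  | succ n =>
    rw [gfun_succ, smul_smul]
    congr 1
    push_cast
    field_simp

/-- Differentiating exp(∑ c p_k t^k/k) in p_k multiplies it by c t^k/k. -/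
lemma pderiv_gfun (c : ℝ) (k : ℕ+) (n : ℕ) :
    pderiv k (gfun c n) = if (k : ℕ) ≤ n then (c / (k : ℕ)) • gfun c (n - k) else 0 := by
  classical
  induction n using Nat.strong_induction_on with
  | _ n ih =>
  have hk := k.pos
  have hk' : ((k : ℕ) : ℝ) ≠ 0 := by positivity
  cases n with
  | zero => rw [gfun_zero, if_neg (by omega)]; exact Derivation.map_one_eq_zero _
  | succ n =>
    rw [gfun_succ, Derivation.map_smul, map_sum]
    have h1 : ∀ i ∈ range (n + 1), pderiv k (X (Nat.succPNat (n - i)) * gfun c i)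
        = (if i + k = n + 1 then gfun c i else 0)
          + (if (k : ℕ) ≤ i then (c / (k : ℕ)) • (X (Nat.succPNat (n - i)) * gfun c (i - k))
            else 0) := by
      intro i hi
      have hi' := Finset.mem_range.mp hi
      rw [pderiv_mul, ih i hi', pderiv_X, Pi.single_apply]
      congr 1
      · have : Nat.succPNat (n - i) = k ↔ i + k = n + 1 := by
          rw [← PNat.coe_inj, Nat.succPNat_coe]
          omega
        simp only [this, ite_mul, one_mul, zero_mul]
      · split_ifs
        · rw [mul_smul_comm]
        · rw [mul_zero]
    rw [Finset.sum_congr rfl h1, Finset.sum_add_distrib]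
    by_cases hkn : (k : ℕ) ≤ n + 1
    · rw [if_pos hkn, Finset.sum_eq_single (n + 1 - (k : ℕ))
        (fun i _ hi => if_neg (by omega)) (fun h => absurd (Finset.mem_range.mpr (by omega)) h),
        if_pos (by omega)]
      have h2 : ∑ i ∈ range (n + 1), (if (k : ℕ) ≤ i then
            (c / (k : ℕ)) • (X (Nat.succPNat (n - i)) * gfun c (i - k)) else 0)
          = (c / (k : ℕ)) • ∑ i ∈ range (n + 1 - k),
              X (Nat.succPNat (n + 1 - k - 1 - i)) * gfun c i := by
        rw [← Nat.add_sub_cancel' hkn, Finset.sum_range_add, Finset.sum_eq_zero, zero_add,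
          Finset.smul_sum]
        · refine Finset.sum_congr (by congr 1; omega) fun i hi => ?_
          rw [if_pos (by omega)]
          congr 4 <;> omega
        · intro i hi
          have := Finset.mem_range.mp hi
          rw [if_neg (by omega)]
      have h3 := natCast_smul_gfun c (n + 1 - k)
      rw [h2, smul_add, smul_smul,
        show c / ((n : ℝ) + 1) * (c / (k : ℕ)) = c / (k : ℕ) / (n + 1) * c by ring, mul_smul,
        ← h3, smul_smul, ← add_smul]
      congr 1
      rw [Nat.cast_sub hkn]
      push_cast
      field_simp
      ring
    · rw [if_neg hkn, Finset.sum_eq_zero, Finset.sum_eq_zero]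
      · simp
      · intro i hi
        have := Finset.mem_range.mp hi
        rw [if_neg (by omega)]
      · intro i hi
        have := Finset.mem_range.mp hi
        rw [if_neg (by omega)]

lemma constantCoeff_gfun (c : ℝ) (n : ℕ) :
    constantCoeff (gfun c n) = if n = 0 then 1 else 0 := by
  cases n with
  | zero => simp
  | succ n =>
    rw [gfun_succ, constantCoeff_smul, map_sum, Finset.sum_eq_zero (by simp)]
    simp

lemma toVars_X (n : ℕ) (k : ℕ+) : toVars n (X k) = psum (Fin n) ℝ (k : ℕ) := by
  simp [toVars]

lemma coeff_mul_psum {n : ℕ} (a : Fin n →₀ ℕ) (p : MvPolynomial (Fin n) ℝ) (k : ℕ) :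
    coeff a (p * psum (Fin n) ℝ k)
      = ∑ i, if k ≤ a i then coeff (a - Finsupp.single i k) p else 0 := by
  rw [psum, Finset.mul_sum, coeff_sum]
  refine Finset.sum_congr rfl fun i _ => ?_
  rw [X_pow_eq_monomial, coeff_mul_monomial', mul_one]
  simp only [Finsupp.single_le_iff]

lemma derivation_prod {R A ι : Type*} [CommSemiring R] [CommSemiring A] [Algebra R A]
    [DecidableEq ι] (D : Derivation R A A) (s : Finset ι) (f : ι → A) :
    D (∏ i ∈ s, f i) = ∑ i ∈ s, (∏ j ∈ s.erase i, f j) * D (f i) := by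
  induction s using Finset.induction_on with
  | empty => simp
  | insert i s hi ih =>
    rw [Finset.prod_insert hi, Finset.sum_insert hi, Derivation.leibniz, ih,
      Finset.erase_insert hi, smul_eq_mul, smul_eq_mul, Finset.mul_sum, add_comm]
    congr 1
    refine Finset.sum_congr rfl fun j hj => ?_
    have hij : i ≠ j := fun h => hi (h ▸ hj)
    rw [Finset.erase_insert_of_ne hij, Finset.prod_insert (fun h => hi (Finset.mem_of_mem_erase h)),
      mul_assoc]

/-- By the Leibniz rule one index at a time drops by k, exactly as exponents do in `coeff_mul_psum`.
This match drives the induction in `hall_prod_gfun`. -/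
lemma pderiv_prod_gfun (c : ℝ) (k : ℕ+) {n : ℕ} (a : Fin n →₀ ℕ) :
    pderiv k (∏ i, gfun c (a i)) = (c / (k : ℕ)) • ∑ i, if (k : ℕ) ≤ a i then
      ∏ j, gfun c ((a - Finsupp.single i (k : ℕ) : Fin n →₀ ℕ) j) else 0 := by
  classical
  rw [derivation_prod, Finset.smul_sum]
  refine Finset.sum_congr rfl fun i _ => ?_
  rw [pderiv_gfun]
  split_ifs with h
  · rw [← Finset.mul_prod_erase univ
      (fun j => gfun c ((a - Finsupp.single i (k : ℕ) : Fin n →₀ ℕ) j)) (Finset.mem_univ i)]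
    rw [mul_smul_comm, mul_comm]
    simp only [Finsupp.coe_tsub, Pi.sub_apply, Finsupp.single_eq_same]
    congr 2
    refine Finset.prod_congr rfl fun j hj => ?_
    simp [(Finset.mem_erase.mp hj).1]
  · simp

/-- The products of one-row functions are dual to the monomials. -/
theorem hall_prod_gfun {τ : ℝ} (hτ : τ ≠ 0) {n : ℕ} (a : Fin n →₀ ℕ) (f : SymFun) :
    hall τ (∏ i, gfun τ (a i)) f = coeff a (toVars n f) := by
  classical
  induction f using MvPolynomial.induction_on generalizing a with
  | C r =>
    have h1 : (C r : SymFun) = monomial 0 r := rfl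
    have h2 : toVars n (C r) = C r := by simp [toVars]
    rw [h2, coeff_C, hall_comm, h1, hall_monomial]
    have h3 : coeff 0 (∏ i, gfun τ (a i)) = ∏ i, if a i = 0 then (1 : ℝ) else 0 := by
      rw [← constantCoeff_eq, map_prod]
      exact Finset.prod_congr rfl fun i _ => constantCoeff_gfun _ _
    rw [h3]
    by_cases h : (0 : Fin n →₀ ℕ) = a
    · simp [← h, hallNorm]
    · rw [if_neg h]
      obtain ⟨i, hi⟩ : ∃ i, a i ≠ 0 := by
        by_contra hcon
        push Not at hcon
        exact h (by ext i; simp [hcon i])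
      rw [Finset.prod_eq_zero (Finset.mem_univ i) (by rw [if_neg hi])]
      ring
  | add p q hp hq => rw [hall_add, hp, hq, map_add, coeff_add]
  | mul_X p k hp =>
    have hk : ((k : ℕ) : ℝ) ≠ 0 := by exact_mod_cast k.ne_zero
    rw [map_mul, toVars_X, coeff_mul_psum, mul_comm p, hall_X_mul, pderiv_prod_gfun,
      hall_smul_left, hall_sum_left, ← mul_assoc,
      show ((k : ℕ) : ℝ) / τ * (τ / (k : ℕ)) = 1 by field_simp, one_mul]
    refine Finset.sum_congr rfl fun i _ => ?_
    split_ifs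
    · exact hp _
    · rw [hall_comm, hall_zero]

end Jack

end

noncomputable section

namespace Jack

open MvPolynomial Finset

/-! ### Monomial symmetric functions -/

/-- The product of the one-row functions indexed by the entries of `s`. -/
def gprod (τ : ℝ) (s : Multiset ℕ) : SymFun := (s.map (gfun τ)).prod

lemma prod_gfun_eq (τ : ℝ) {n : ℕ} (a : Fin n →₀ ℕ) :
    ∏ i, gfun τ (a i) = gprod τ (univ.val.map a) := by
  rw [gprod, Multiset.map_map]
  rfl

lemma exists_exponent (s : Multiset ℕ) :
    ∃ a : Fin (Multiset.card s) →₀ ℕ, univ.val.map a = s := by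
  induction s using Quotient.inductionOn with
  | _ l =>
    refine ⟨Finsupp.equivFunOnFinite.symm l.get, ?_⟩
    change Multiset.map l.get univ.val = _
    rw [Fin.univ_val_map, List.ofFn_get]
    rfl

lemma sum_filter_ne_zero (s : Multiset ℕ) : (s.filter (· ≠ 0)).sum = s.sum := by
  induction s using Multiset.induction_on with
  | empty => rfl
  | cons b s ih =>
    by_cases hb : b = 0
    · simpa [hb] using ih
    · rw [Multiset.filter_cons_of_pos (p := fun x => x ≠ 0) _ hb, Multiset.sum_cons, Multiset.sum_cons, ih]

lemma ofSym_parts {n d : ℕ} (s : Sym (Fin n) d) :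
    (Nat.Partition.ofSym s).parts
      = (univ.val.map (Multiset.toFinsupp s.1)).filter (· ≠ 0) := by
  classical
  have h1 : (Nat.Partition.ofSym s).parts = s.1.dedup.map s.1.count := rfl
  rw [h1, Multiset.filter_map]
  have h2 : s.1.dedup
      = Multiset.filter ((fun x => x ≠ 0) ∘ (Multiset.toFinsupp s.1)) univ.val := by
    have : s.1.toFinset = univ.filter ((fun x => x ≠ 0) ∘ (Multiset.toFinsupp s.1)) := by
      ext i
      rw [Multiset.mem_toFinset, Finset.mem_filter]
      simp
    exact congrArg Finset.val this
  rw [h2]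
  refine Multiset.map_congr rfl fun i _ => ?_
  simp

lemma multiset_map_X_prod {n : ℕ} (s : Multiset (Fin n)) :
    (s.map (X : Fin n → MvPolynomial (Fin n) ℝ)).prod = monomial (Multiset.toFinsupp s) 1 := by
  classical
  induction s using Multiset.induction_on with
  | empty => simp
  | cons i s ih =>
    rw [Multiset.map_cons, Multiset.prod_cons, ih, X, monomial_mul, ← Multiset.singleton_add,
      map_add, Multiset.toFinsupp_singleton, one_mul]

/-- The coefficients of the monomial symmetric polynomials. -/
lemma coeff_msymm {n d : ℕ} (a : Fin n →₀ ℕ) (mu : d.Partition) :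
    coeff a (msymm (Fin n) ℝ mu)
      = if (univ.val.map a).filter (· ≠ 0) = mu.parts then 1 else 0 := by
  classical
  rw [msymm, coeff_sum]
  simp_rw [multiset_map_X_prod, coeff_monomial]
  split_ifs with h
  · have hcard : Multiset.card (Finsupp.toMultiset a) = d := by
      rw [Finsupp.card_toMultiset, ← mu.parts_sum, ← h, Finsupp.sum_fintype _ _ (fun _ => rfl)]
      rw [sum_filter_ne_zero]
      rfl
    let t : Sym (Fin n) d := ⟨Finsupp.toMultiset a, hcard⟩
    have ht : Nat.Partition.ofSym t = mu := by
      ext1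
      rw [ofSym_parts, ← h]
      simp [t]
    rw [Finset.sum_eq_single (⟨t, ht⟩ : {x : Sym (Fin n) d // Nat.Partition.ofSym x = mu})]
    · simp [t]
    · intro b _ hb
      rw [if_neg]
      intro hab
      refine hb (Subtype.ext (Subtype.ext ?_))
      have := congrArg Finsupp.toMultiset hab
      simpa [t] using this
    · simp
  · refine Finset.sum_eq_zero fun b _ => if_neg fun hab => h ?_
    rw [← hab, ← ofSym_parts, b.2]

lemma gprod_filter (τ : ℝ) (s : Multiset ℕ) : gprod τ (s.filter (· ≠ 0)) = gprod τ s := by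
  induction s using Multiset.induction_on with
  | empty => rfl
  | cons b s ih =>
    by_cases hb : b = 0
    · simpa [hb, gprod] using ih
    · rw [Multiset.filter_cons_of_pos (p := fun x => x ≠ 0) _ hb]
      simp only [gprod, Multiset.map_cons, Multiset.prod_cons] at ih ⊢
      rw [ih]

/-- The recursion for g_{n+1} contains p_{n+1} with the invertible coefficient τ/(n+1) and otherwise
only earlier power sums, so it can be solved for p_{n+1}. -/
lemma X_mem_adjoin_gfun {τ : ℝ} (hτ : τ ≠ 0) (n : ℕ) :
    (X (Nat.succPNat n) : SymFun) ∈ Algebra.adjoin ℝ (Set.range (gfun τ)) := by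
  induction n using Nat.strong_induction_on with
  | _ n ih =>
    have hg : ∀ i, gfun τ i ∈ Algebra.adjoin ℝ (Set.range (gfun τ)) :=
      fun i => Algebra.subset_adjoin ⟨i, rfl⟩
    have h := gfun_succ τ n
    rw [Finset.sum_range_succ', gfun_zero, mul_one, Nat.sub_zero] at h
    have h1 : (X (Nat.succPNat n) : SymFun) = (((n : ℝ) + 1) / τ) • gfun τ (n + 1)
        - ∑ i ∈ range n, X (Nat.succPNat (n - (i + 1))) * gfun τ (i + 1) := by
      rw [h, smul_smul, show ((n : ℝ) + 1) / τ * (τ / (n + 1)) = 1 by field_simp, one_smul]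
      ring
    rw [h1]
    refine Subalgebra.sub_mem _ (Subalgebra.smul_mem _ (hg _) _)
      (Subalgebra.sum_mem _ fun i hi => Subalgebra.mul_mem _ (ih _ ?_) (hg _))
    have := Finset.mem_range.mp hi
    omega

/-- A symmetric function orthogonal to all products of one-row functions vanishes. -/
lemma eq_zero_of_hall_gprod {τ : ℝ} (hτ : 0 < τ) {f : SymFun}
    (hf : ∀ s, hall τ (gprod τ s) f = 0) : f = 0 := by
  have htop : Algebra.adjoin ℝ (Set.range (gfun τ)) = ⊤ := by
    rw [eq_top_iff, ← MvPolynomial.adjoin_range_X, Algebra.adjoin_le_iff]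
    rintro _ ⟨k, rfl⟩
    have := X_mem_adjoin_gfun hτ.ne' k.natPred
    rwa [PNat.succPNat_natPred] at this
  refine eq_zero_of_hall_self hτ ?_
  have hmem : f ∈ Submodule.span ℝ
      (Submonoid.closure (Set.range (gfun τ)) : Set SymFun) := by
    rw [← Algebra.adjoin_eq_span, htop]
    trivial
  have key : ∀ h ∈ Submodule.span ℝ (Submonoid.closure (Set.range (gfun τ)) : Set SymFun),
      hall τ h f = 0 := by
    intro h hh
    induction hh using Submodule.span_induction with
    | mem x hx =>
      obtain ⟨l, hl, rfl⟩ := Submonoid.exists_multiset_of_mem_closure hx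
      obtain ⟨s, rfl⟩ : ∃ s : Multiset ℕ, s.map (gfun τ) = l := by
        choose! g hg using hl
        refine ⟨l.map g, ?_⟩
        rw [Multiset.map_map]
        conv_rhs => rw [← Multiset.map_id l]
        exact Multiset.map_congr rfl fun x hx => hg x hx
      exact hf s
    | zero => rw [hall_comm, hall_zero]
    | add x y _ _ hx hy => rw [hall_add_left, hx, hy, add_zero]
    | smul c x _ hx => rw [hall_smul_left, hx, mul_zero]
  exact key f hmem

lemma hall_gprod_of_toVars {τ : ℝ} (hτ : τ ≠ 0) (s : Multiset ℕ) (f : SymFun) :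
    ∃ a : Fin (Multiset.card s) →₀ ℕ, univ.val.map a = s ∧
      hall τ (gprod τ s) f = coeff a (toVars (Multiset.card s) f) := by
  obtain ⟨a, ha⟩ := exists_exponent s
  refine ⟨a, ha, ?_⟩
  rw [← hall_prod_gfun hτ, prod_gfun_eq, ha]

/-- Allows identities in Λ to be checked in finitely many variables. The form at parameter 1 is only
a tool: by duality its pairings with one-row products are coefficients of the images. -/
lemma toVars_injective {f g : SymFun} (h : ∀ n, toVars n f = toVars n g) : f = g := by
  rw [← sub_eq_zero]
  refine eq_zero_of_hall_gprod one_pos fun s => ?_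
  obtain ⟨a, -, ha⟩ := hall_gprod_of_toVars one_ne_zero s (f - g)
  rw [ha, map_sub, h, sub_self, coeff_zero]

/-- `f` is homogeneous of degree `d` as a symmetric function. -/
def Homog (d : ℕ) (f : SymFun) : Prop := ∀ n, (toVars n f).IsHomogeneous d

lemma Homog.mul {d e : ℕ} {f g : SymFun} (hf : Homog d f) (hg : Homog e g) :
    Homog (d + e) (f * g) := fun n => by
  rw [map_mul]
  exact (hf n).mul (hg n)

lemma Homog.smul {d : ℕ} {f : SymFun} (hf : Homog d f) (c : ℝ) : Homog d (c • f) := fun n => by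
  rw [map_smul]
  exact Submodule.smul_mem (homogeneousSubmodule (Fin n) ℝ d) c (hf n)

lemma Homog.sum {d : ℕ} {ι : Type*} {s : Finset ι} {f : ι → SymFun}
    (hf : ∀ i ∈ s, Homog d (f i)) : Homog d (∑ i ∈ s, f i) := fun n => by
  rw [map_sum]
  exact IsHomogeneous.sum _ _ _ fun i hi => hf i hi n

lemma homog_one : Homog 0 1 := fun n => by
  rw [map_one]
  exact isHomogeneous_one _ _

lemma homog_X (k : ℕ+) : Homog k (X k) := fun n => by
  rw [toVars_X, psum]
  exact IsHomogeneous.sum _ _ _ fun i _ => isHomogeneous_X_pow _ _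

lemma homog_gfun (c : ℝ) (n : ℕ) : Homog n (gfun c n) := by
  induction n using Nat.strong_induction_on with
  | _ n ih =>
    cases n with
    | zero => rw [gfun_zero]; exact homog_one
    | succ n =>
      rw [gfun_succ]
      refine Homog.smul (Homog.sum fun i hi => ?_) _
      have hi' := Finset.mem_range.mp hi
      have := (homog_X (Nat.succPNat (n - i))).mul (ih i hi')
      rwa [Nat.succPNat_coe, show (n - i).succ + i = n + 1 by omega] at this

lemma homog_gprod (c : ℝ) (s : Multiset ℕ) : Homog s.sum (gprod c s) := by
  induction s using Multiset.induction_on with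
  | empty => exact homog_one
  | cons b s ih =>
    rw [gprod, Multiset.map_cons, Multiset.prod_cons, Multiset.sum_cons]
    exact (homog_gfun c b).mul ih

lemma hall_gprod_eq_zero {τ : ℝ} (hτ : τ ≠ 0) {d : ℕ} {f : SymFun} (hf : Homog d f)
    {s : Multiset ℕ} (hs : s.sum ≠ d) : hall τ (gprod τ s) f = 0 := by
  obtain ⟨a, ha, h⟩ := hall_gprod_of_toVars hτ s f
  rw [h]
  refine (hf _).coeff_eq_zero ?_
  rw [Finsupp.degree_eq_sum]
  rw [← ha] at hs
  exact hs

lemma exists_partition {d : ℕ} {s : Multiset ℕ} (hs : s.sum = d) :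
    ∃ nu : d.Partition, nu.parts = s.filter (· ≠ 0) :=
  ⟨⟨s.filter (· ≠ 0), fun hi => Nat.pos_of_ne_zero (Multiset.mem_filter.mp hi).2, by
    rw [sum_filter_ne_zero, hs]⟩, rfl⟩

/-- A homogeneous symmetric function orthogonal to all products of one-row functions indexed by
partitions vanishes. -/
lemma Homog.eq_zero {τ : ℝ} (hτ : 0 < τ) {d : ℕ} {f : SymFun} (hf : Homog d f)
    (h : ∀ nu : d.Partition, hall τ (gprod τ nu.parts) f = 0) : f = 0 := by
  refine eq_zero_of_hall_gprod hτ fun s => ?_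
  by_cases hs : s.sum = d
  · obtain ⟨nu, hnu⟩ := exists_partition hs
    rw [← gprod_filter, ← hnu, h]
  · exact hall_gprod_eq_zero hτ.ne' hf hs

/-- The product of the power sums indexed by the entries of `s`. -/
def pprod (s : Multiset ℕ) : SymFun := (s.map fun k => X k.toPNat').prod

lemma homog_pprod {s : Multiset ℕ} (hs : ∀ i ∈ s, 0 < i) : Homog s.sum (pprod s) := by
  induction s using Multiset.induction_on with
  | empty => exact homog_one
  | cons b s ih =>
    rw [pprod, Multiset.map_cons, Multiset.prod_cons, Multiset.sum_cons]
    have h1 := homog_X b.toPNat'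
    rw [Nat.toPNat'_coe, if_pos (hs b (by simp))] at h1
    exact h1.mul (ih fun i hi => hs i (by simp [hi]))

lemma pprod_eq_monomial (s : Multiset ℕ) :
    pprod s = monomial (Multiset.toFinsupp (s.map Nat.toPNat')) 1 := by
  induction s using Multiset.induction_on with
  | empty => simp [pprod]
  | cons b s ih =>
    rw [pprod, Multiset.map_cons, Multiset.prod_cons, ← pprod, ih, X, monomial_mul,
      Multiset.map_cons, ← Multiset.singleton_add, map_add, Multiset.toFinsupp_singleton, one_mul]

lemma map_toPNat'_injective {d : ℕ} {lam mu : d.Partition}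
    (h : lam.parts.map Nat.toPNat' = mu.parts.map Nat.toPNat') : lam = mu := by
  have key : ∀ nu : d.Partition, (nu.parts.map Nat.toPNat').map (fun k : ℕ+ => (k : ℕ))
      = nu.parts := by
    intro nu
    rw [Multiset.map_map]
    conv_rhs => rw [← Multiset.map_id nu.parts]
    refine Multiset.map_congr rfl fun i hi => ?_
    simp [Nat.toPNat'_coe, nu.parts_pos hi]
  ext1
  rw [← key lam, ← key mu, h]

/-! ### Existence of the monomial symmetric functions by a dimension count -/

lemma linearIndependent_pprod (d : ℕ) :
    LinearIndependent ℝ fun nu : d.Partition => pprod nu.parts := by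
  have h1 : Function.Injective fun nu : d.Partition =>
      Multiset.toFinsupp (nu.parts.map Nat.toPNat') := fun lam mu h =>
    map_toPNat'_injective (Multiset.toFinsupp.injective h)
  have h2 := (basisMonomials ℕ+ ℝ).linearIndependent.comp _ h1
  have h3 : (fun nu : d.Partition => pprod nu.parts) = (basisMonomials ℕ+ ℝ) ∘
      fun nu : d.Partition => Multiset.toFinsupp (nu.parts.map Nat.toPNat') := by
    funext nu
    simp [pprod_eq_monomial]
  rw [h3]
  exact h2

/-- On combinations of the p_ρ with |ρ| = d, the pairings with the one-row products give an
injective map between spaces of the same finite dimension, hence a surjective one. -/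
lemma exists_dual (d : ℕ) (nu : d.Partition) : ∃ f : SymFun, Homog d f ∧
    ∀ mu : d.Partition, hall 1 (gprod 1 mu.parts) f = if mu = nu then 1 else 0 := by
  classical
  let F : (d.Partition → ℝ) → SymFun := fun c => ∑ rho, c rho • pprod rho.parts
  have hF : ∀ c, Homog d (F c) := fun c => Homog.sum fun rho _ => by
    have := homog_pprod (s := rho.parts) fun i hi => rho.parts_pos hi
    rw [rho.parts_sum] at this
    exact this.smul _
  let A : (d.Partition → ℝ) →ₗ[ℝ] (d.Partition → ℝ) :=
    { toFun := fun c mu => hall 1 (gprod 1 mu.parts) (F c)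
      map_add' := fun c c' => by
        funext mu
        simp only [F, Pi.add_apply, add_smul, Finset.sum_add_distrib, hall_add]
      map_smul' := fun r c => by
        funext mu
        simp only [F, Pi.smul_apply, smul_eq_mul, mul_smul, ← Finset.smul_sum, hall_smul,
          RingHom.id_apply] }
  have hA : Function.Injective A := by
    rw [← LinearMap.ker_eq_bot, LinearMap.ker_eq_bot']
    intro c hc
    have h0 : F c = 0 := (hF c).eq_zero one_pos fun mu => congrFun hc mu
    funext rho
    exact Fintype.linearIndependent_iff.mp (linearIndependent_pprod d) c h0 rho
  obtain ⟨c, hc⟩ := (LinearMap.injective_iff_surjective.mp hA) fun mu => if mu = nu then 1 else 0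
  exact ⟨F c, hF c, fun mu => congrFun hc mu⟩

/-- The dual element from `exists_dual` has the right coefficients, since by duality its coefficient
at x^a depends only on the multiset of nonzero exponents. This makes the `epsilon` in `monomialFun`
meaningful. -/
lemma exists_monomialFun {d : ℕ} (nu : d.Partition) :
    ∃ f : SymFun, ∀ n, toVars n f = msymm (Fin n) ℝ nu := by
  classical
  obtain ⟨f, hf, h⟩ := exists_dual d nu
  refine ⟨f, fun n => ?_⟩
  ext a
  rw [coeff_msymm, ← hall_prod_gfun one_ne_zero, prod_gfun_eq]
  by_cases hs : (univ.val.map a).sum = d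
  · obtain ⟨mu, hmu⟩ := exists_partition hs
    rw [← gprod_filter, ← hmu, h mu]
    simp only [Nat.Partition.ext_iff]
  · rw [hall_gprod_eq_zero one_ne_zero hf hs, if_neg]
    intro hcon
    rw [← sum_filter_ne_zero, hcon, nu.parts_sum] at hs
    exact hs rfl

lemma toVars_monomialFun {d : ℕ} (nu : d.Partition) (n : ℕ) :
    toVars n (monomialFun nu) = msymm (Fin n) ℝ nu :=
  Classical.epsilon_spec (exists_monomialFun nu) n

lemma hall_gprod_monomialFun {τ : ℝ} (hτ : τ ≠ 0) {d : ℕ} (s : Multiset ℕ) (nu : d.Partition) :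
    hall τ (gprod τ s) (monomialFun nu) = if s.filter (· ≠ 0) = nu.parts then 1 else 0 := by
  obtain ⟨a, ha, h⟩ := hall_gprod_of_toVars hτ s (monomialFun nu)
  rw [h, toVars_monomialFun, coeff_msymm, ha]

lemma filter_parts {d : ℕ} (nu : d.Partition) : nu.parts.filter (· ≠ 0) = nu.parts :=
  Multiset.filter_eq_self.mpr fun _ hi => (nu.parts_pos hi).ne'

lemma hall_gprod_parts_monomialFun {τ : ℝ} (hτ : τ ≠ 0) {d : ℕ} (mu nu : d.Partition) :
    hall τ (gprod τ mu.parts) (monomialFun nu) = if mu = nu then 1 else 0 := by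
  rw [hall_gprod_monomialFun hτ, filter_parts]
  simp only [Nat.Partition.ext_iff]

lemma homog_monomialFun {d : ℕ} (nu : d.Partition) : Homog d (monomialFun nu) := fun n => by
  rw [toVars_monomialFun]
  intro a ha
  rw [coeff_msymm] at ha
  have h1 : (univ.val.map a).filter (· ≠ 0) = nu.parts := by
    by_contra hcon
    exact ha (if_neg hcon)
  have h2 := nu.parts_sum
  rw [← h1, sum_filter_ne_zero] at h2
  rw [← h2]
  change Finsupp.weight 1 a = ∑ i, a i
  rw [← Finsupp.degree_eq_sum, Finsupp.degree_eq_weight_one]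
  rfl

/-- The expansion of a homogeneous symmetric function in monomial symmetric functions. -/
lemma Homog.eq_sum {τ : ℝ} (hτ : 0 < τ) {d : ℕ} {f : SymFun} (hf : Homog d f) :
    f = ∑ nu : d.Partition, hall τ (gprod τ nu.parts) f • monomialFun nu := by
  classical
  rw [← sub_eq_zero]
  have h1 : Homog d (f - ∑ nu : d.Partition, hall τ (gprod τ nu.parts) f • monomialFun nu) := by
    intro n
    rw [map_sub]
    exact (hf n).sub ((Homog.sum fun nu _ => (homog_monomialFun nu).smul _) n)
  refine h1.eq_zero hτ fun mu => ?_
  rw [hall_sub, hall_sum]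
  simp_rw [hall_smul, hall_gprod_parts_monomialFun hτ.ne']
  simp

/-! ### Uniqueness of Jack expansions -/

/-- The difference of two expansions is spanned by terms strictly below `lam` and orthogonal to all
of these, hence to itself. -/
lemma IsJackExpansion.unique {τ : ℝ} (hτ : 0 < τ) {d : ℕ} {lam : d.Partition}
    {K K' : d.Partition → ℝ} (hK : IsJackExpansion τ lam K) (hK' : IsJackExpansion τ lam K') :
    K = K' := by
  classical
  have h0 : ∑ nu, (K nu - K' nu) • monomialFun nu = 0 := by
    refine eq_zero_of_hall_self hτ ?_
    rw [hall_sum]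
    refine Finset.sum_eq_zero fun mu _ => ?_
    rw [hall_smul]
    by_cases hmu : mu = lam
    · rw [hmu, hK.1, hK'.1, sub_self, zero_mul]
    · by_cases hmaj : Majorizes lam mu
      · have h1 := hK.2.2 mu hmaj hmu
        have h2 := hK'.2.2 mu hmaj hmu
        simp_rw [sub_smul]
        rw [Finset.sum_sub_distrib, hall_comm, hall_sub, hall_comm, h1, hall_comm, h2]
        ring
      · have h1 : K mu = 0 := by
          by_contra h
          exact hmaj (hK.2.1 mu h)
        have h2 : K' mu = 0 := by
          by_contra h
          exact hmaj (hK'.2.1 mu h)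
        rw [h1, h2, sub_self, zero_mul]
  funext mu
  have h1 := congrArg (hall τ (gprod τ mu.parts)) h0
  rw [hall_sum, hall_zero] at h1
  simp_rw [hall_smul, hall_gprod_parts_monomialFun hτ.ne'] at h1
  simpa [sub_eq_zero] using h1

lemma jackCoeffReal_eq {τ : ℝ} (hτ : 0 < τ) {d : ℕ} {lam : d.Partition}
    {K : d.Partition → ℝ} (hK : IsJackExpansion τ lam K) (mu : d.Partition) :
    jackCoeffReal lam mu τ = K mu := by
  have h : IsJackExpansion τ lam (Classical.epsilon fun K' => IsJackExpansion τ lam K') :=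
    Classical.epsilon_spec (p := fun K' => IsJackExpansion τ lam K') ⟨K, hK⟩
  exact congrFun (h.unique hτ hK) mu

end Jack

end

/-! ### Gegenbauer polynomials as restrictions of one-row functions -/

noncomputable section

namespace Jack

/-! ### Orthogonal polynomials given by a three-term recurrence -/

/-- The solution of `Q (m + 2) = u * Q (m + 1) - b m • (v * Q m)` with `Q 0 = 1`, `Q 1 = u`. -/
def threeTerm {R : Type*} [CommRing R] [Algebra ℝ R] (b : ℕ → ℝ) (u v : R) : ℕ → R
  | 0 => 1
  | 1 => u
  | m + 2 => u * threeTerm b u v (m + 1) - b m • (v * threeTerm b u v m)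

section threeTerm

variable {R : Type*} [CommRing R] [Algebra ℝ R] (b : ℕ → ℝ) (u v : R)

@[simp] lemma threeTerm_zero : threeTerm b u v 0 = 1 := by rw [threeTerm]

@[simp] lemma threeTerm_one : threeTerm b u v 1 = u := by rw [threeTerm]

lemma threeTerm_add_two (m : ℕ) : threeTerm b u v (m + 2)
    = u * threeTerm b u v (m + 1) - b m • (v * threeTerm b u v m) := by rw [threeTerm]

lemma map_threeTerm {S : Type*} [CommRing S] [Algebra ℝ S] (f : R →ₐ[ℝ] S) (m : ℕ) :
    f (threeTerm b u v m) = threeTerm b (f u) (f v) m := by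
  induction m using Nat.twoStepInduction with
  | zero => simp
  | one => simp
  | more m h0 h1 => rw [threeTerm_add_two, threeTerm_add_two, map_sub, map_smul, map_mul, map_mul,
      h0, h1]

end threeTerm

open Polynomial

/-- The monic orthogonal polynomials with recurrence coefficients `b`. -/
def orthoPoly (b : ℕ → ℝ) (m : ℕ) : ℝ[X] := threeTerm b X 1 m

lemma orthoPoly_add_two (b : ℕ → ℝ) (m : ℕ) :
    orthoPoly b (m + 2) = X * orthoPoly b (m + 1) - b m • orthoPoly b m := by
  rw [orthoPoly, threeTerm_add_two, one_mul]
  rfl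

lemma orthoPoly_natDegree_monic (b : ℕ → ℝ) (m : ℕ) :
    (orthoPoly b m).natDegree = m ∧ (orthoPoly b m).Monic := by
  induction m using Nat.twoStepInduction with
  | zero => simp [orthoPoly]
  | one => simp [orthoPoly, monic_X]
  | more m h0 h1 =>
    rw [orthoPoly_add_two]
    have h2 : (X * orthoPoly b (m + 1)).Monic := monic_X.mul h1.2
    have h3 : (X * orthoPoly b (m + 1)).natDegree = m + 2 := by
      rw [monic_X.natDegree_mul h1.2, h1.1, natDegree_X]
      ring
    have h4 : (b m • orthoPoly b m).degree < (X * orthoPoly b (m + 1)).degree := by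
      refine lt_of_le_of_lt (degree_smul_le _ _) ?_
      rw [degree_eq_natDegree h2.ne_zero, degree_eq_natDegree h0.2.ne_zero, h3, h0.1]
      exact_mod_cast (by omega : m < m + 2)
    refine ⟨?_, h2.sub_of_left h4⟩
    rw [natDegree_sub_eq_left_of_natDegree_lt, h3]
    rw [h3]
    refine lt_of_le_of_lt (natDegree_smul_le _ _) ?_
    rw [h0.1]
    omega

lemma natDegree_orthoPoly (b : ℕ → ℝ) (m : ℕ) : (orthoPoly b m).natDegree = m :=
  (orthoPoly_natDegree_monic b m).1

lemma monic_orthoPoly (b : ℕ → ℝ) (m : ℕ) : (orthoPoly b m).Monic :=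
  (orthoPoly_natDegree_monic b m).2

/-- Favard's theorem: a linear functional for which the polynomials `orthoPoly b` are orthogonal. -/
lemma exists_functional (b : ℕ → ℝ) : ∃ L : ℝ[X] →ₗ[ℝ] ℝ, ∀ (m : ℕ) (f : ℝ[X]),
    f.natDegree ≤ m → L (f * orthoPoly b m) = f.coeff m * ∏ j ∈ Finset.range m, b j := by
  let S : Polynomial.Sequence ℝ := ⟨orthoPoly b, fun i => by
    rw [degree_eq_natDegree (monic_orthoPoly b i).ne_zero, natDegree_orthoPoly]⟩
  have hS : ∀ i, S i = orthoPoly b i := fun i => rfl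
  let B := S.basis fun i => by
    rw [hS, (monic_orthoPoly b i).leadingCoeff]
    exact isUnit_one
  have hB : ∀ i, B i = orthoPoly b i := fun i => by
    rw [Polynomial.Sequence.basis_eq_self]
  -- L reads off the constant coordinate in the basis `orthoPoly b`; the recurrence then turns
  -- multiplication by X into a shift of the index.
  let L := B.constr ℝ (fun i : ℕ => if i = 0 then (1 : ℝ) else 0)
  have hL : ∀ i, L (orthoPoly b i) = if i = 0 then (1 : ℝ) else 0 := fun i => by
    rw [← hB, Module.Basis.constr_basis]
  have hX : ∀ m, X * orthoPoly b (m + 1) = orthoPoly b (m + 2) + b m • orthoPoly b m := fun m => by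
    rw [orthoPoly_add_two]
    ring
  have h1 : ∀ i m, i < m → L (X ^ i * orthoPoly b m) = 0 := by
    intro i
    induction i with
    | zero =>
      intro m hm
      rw [pow_zero, one_mul, hL, if_neg (by omega)]
    | succ i ih =>
      intro m hm
      obtain ⟨m, rfl⟩ : ∃ m', m = m' + 1 := ⟨m - 1, by omega⟩
      rw [pow_succ, mul_assoc, hX, mul_add, map_add, ih _ (by omega), mul_smul_comm, map_smul,
        ih _ (by omega), smul_zero, add_zero]
  have h2 : ∀ m, L (X ^ m * orthoPoly b m) = ∏ j ∈ Finset.range m, b j := by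
    intro m
    induction m with
    | zero => rw [pow_zero, one_mul, hL, if_pos rfl, Finset.prod_range_zero]
    | succ m ih =>
      rw [pow_succ, mul_assoc, hX, mul_add, map_add, h1 _ _ (by omega), mul_smul_comm, map_smul,
        ih, zero_add, Finset.prod_range_succ, smul_eq_mul, mul_comm]
  refine ⟨L, fun m f hf => ?_⟩
  conv_lhs => rw [f.as_sum_range_C_mul_X_pow' (Nat.lt_succ_of_le hf)]
  rw [Finset.sum_mul, map_sum, Finset.sum_range_succ, Finset.sum_eq_zero, zero_add]
  · rw [mul_assoc, ← smul_eq_C_mul, map_smul, h2, smul_eq_mul]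
  · intro i hi
    rw [mul_assoc, ← smul_eq_C_mul, map_smul, h1 _ _ (Finset.mem_range.mp hi), smul_zero]

/-! ### Symmetric functions in two variables with product one -/

/-- The recurrence coefficients of the monic Gegenbauer polynomials with parameter `τ`. -/
def gegenCoeff (τ : ℝ) (m : ℕ) : ℝ := (m + 1) * (m + 2 * τ) / ((m + 1 + τ) * (m + τ))

lemma gegenCoeff_pos {τ : ℝ} (hτ : 0 < τ) (m : ℕ) : 0 < gegenCoeff τ m := by
  unfold gegenCoeff
  positivity

/-- The value of a symmetric function at `(z, z⁻¹)`, as a polynomial in `z + z⁻¹`. -/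
def restrict : SymFun →ₐ[ℝ] ℝ[X] := MvPolynomial.aeval fun k : ℕ+ => Chebyshev.C ℝ (k : ℕ)

lemma eval_C_add_inv {z : ℝ} (hz : z ≠ 0) (k : ℕ) :
    (Chebyshev.C ℝ (k : ℕ)).eval (z + z⁻¹) = z ^ k + z⁻¹ ^ k := by
  induction k using Nat.twoStepInduction with
  | zero => norm_num
  | one => simp
  | more k h0 h1 =>
    push_cast at h0 h1 ⊢
    rw [Chebyshev.C_add_two, eval_sub, eval_mul, h0, h1, eval_X]
    linear_combination (z ^ k + z⁻¹ ^ k) * mul_inv_cancel₀ hz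

lemma eval_restrict {z : ℝ} (hz : z ≠ 0) (f : SymFun) :
    (restrict f).eval (z + z⁻¹) = MvPolynomial.eval ![z, z⁻¹] (toVars 2 f) := by
  have : ((Polynomial.aeval (z + z⁻¹)).comp restrict : SymFun →ₐ[ℝ] ℝ)
      = (MvPolynomial.aeval ![z, z⁻¹]).comp (toVars 2) := by
    refine MvPolynomial.algHom_ext fun k => ?_
    rw [AlgHom.comp_apply, AlgHom.comp_apply, toVars_X, MvPolynomial.psum, restrict,
      MvPolynomial.aeval_X]
    have h := eval_C_add_inv hz k
    simp only [Fin.sum_univ_two]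
    simpa [Polynomial.aeval_def, Polynomial.eval₂_eq_eval_map] using h
  have h := DFunLike.congr_fun this f
  simpa [Polynomial.aeval_def, Polynomial.eval₂_eq_eval_map, MvPolynomial.aeval_eq_eval] using h

lemma exists_add_inv {u : ℝ} (hu : 2 ≤ u) : ∃ z : ℝ, 0 < z ∧ z + z⁻¹ = u := by
  have h1 : 0 ≤ u ^ 2 - 4 := by nlinarith
  have h2 := Real.sq_sqrt h1
  have h3 := Real.sqrt_nonneg (u ^ 2 - 4)
  have h4 : 0 < (u + √(u ^ 2 - 4)) / 2 := by positivity
  refine ⟨(u + √(u ^ 2 - 4)) / 2, h4, ?_⟩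
  field_simp
  nlinarith

/-- The numbers z + 1/z with z > 0 fill the infinite set [2, ∞). -/
lemma eq_of_eval_add_inv {f g : ℝ[X]}
    (h : ∀ z : ℝ, 0 < z → f.eval (z + z⁻¹) = g.eval (z + z⁻¹)) : f = g := by
  refine eq_of_infinite_eval_eq f g ((Set.Ici_infinite (2 : ℝ)).mono fun u hu => ?_)
  obtain ⟨z, hz, rfl⟩ := exists_add_inv hu
  exact h z hz

/-- The restricted generating series is (1 - ut + t²)^(-τ) with u = z + 1/z, whose first order
differential equation in t gives this recurrence. Here it is derived from the recursion in power
sums. -/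
lemma restrict_gfun_rec (τ : ℝ) (n : ℕ) :
    ((n : ℝ) + 2) • restrict (gfun τ (n + 2)) = ((n : ℝ) + 1 + τ) • (X * restrict (gfun τ (n + 1)))
      - ((n : ℝ) + 2 * τ) • restrict (gfun τ n) := by
  let S : ℕ → ℝ[X] := fun n =>
    ∑ i ∈ Finset.range n, Chebyshev.C ℝ ((n - i : ℕ) : ℤ) * restrict (gfun τ i)
  have hS : ∀ n : ℕ, (n : ℝ) • restrict (gfun τ n) = τ • S n := by
    intro n
    have h := congrArg restrict (natCast_smul_gfun τ n)
    rw [map_smul, map_smul, map_sum] at h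
    rw [h]
    congr 1
    refine Finset.sum_congr rfl fun i hi => ?_
    have := Finset.mem_range.mp hi
    rw [map_mul, restrict, MvPolynomial.aeval_X, Nat.succPNat_coe]
    congr 4
    omega
  have h1 : S (n + 2) = X * restrict (gfun τ (n + 1)) - 2 * restrict (gfun τ n)
      + X * S (n + 1) - S n := by
    simp only [S]
    rw [Finset.sum_range_succ, Finset.sum_range_succ, Finset.sum_range_succ]
    have h2 : ∀ i ∈ Finset.range n,
        Chebyshev.C ℝ ((n + 2 - i : ℕ) : ℤ) * restrict (gfun τ i)
          = X * (Chebyshev.C ℝ ((n + 1 - i : ℕ) : ℤ) * restrict (gfun τ i))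
            - Chebyshev.C ℝ ((n - i : ℕ) : ℤ) * restrict (gfun τ i) := by
      intro i hi
      have := Finset.mem_range.mp hi
      rw [show ((n + 2 - i : ℕ) : ℤ) = ((n - i : ℕ) : ℤ) + 2 by omega,
        show ((n + 1 - i : ℕ) : ℤ) = ((n - i : ℕ) : ℤ) + 1 by omega, Chebyshev.C_add_two]
      ring
    rw [Finset.sum_congr rfl h2, Finset.sum_sub_distrib, ← Finset.mul_sum,
      show ((n + 2 - n : ℕ) : ℤ) = 2 by omega, show ((n + 2 - (n + 1) : ℕ) : ℤ) = 1 by omega,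
      show ((n + 1 - n : ℕ) : ℤ) = 1 by omega, Chebyshev.C_two, Chebyshev.C_one]
    ring
  have e0 := hS n
  have e1 := hS (n + 1)
  have e2 := hS (n + 2)
  rw [h1] at e2
  push_cast at e0 e1 e2
  simp only [smul_eq_C_mul, C_add, C_mul, C_1] at e0 e1 e2 ⊢
  rw [show (C (2 : ℝ) : ℝ[X]) = 2 from rfl] at *
  -- The combination that annihilates C_{k+2}, C_{k+1}, C_k, leaving only the boundary terms
  -- recorded in `h1`.
  linear_combination e2 - X * e1 + e0

/-- The coefficient of `t ^ n` in `(1 - t) ^ (-τ)`. -/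
def binomWeight (τ : ℝ) (n : ℕ) : ℝ := ∏ i ∈ Finset.range n, (τ + i) / (i + 1)

lemma restrict_gfun {τ : ℝ} (hτ : 0 < τ) (n : ℕ) :
    restrict (gfun τ n) = binomWeight τ n • orthoPoly (gegenCoeff τ) n := by
  induction n using Nat.twoStepInduction with
  | zero => simp [binomWeight, orthoPoly]
  | one =>
    rw [gfun_succ]
    simp [binomWeight, orthoPoly, restrict]
  | more n h0 h1 =>
    have h := restrict_gfun_rec τ n
    rw [h0, h1] at h
    have hn : (n : ℝ) + 2 ≠ 0 := by positivity
    refine smul_right_injective ℝ[X] hn (h.trans ?_)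
    change _ = ((n : ℝ) + 2) • _
    simp only [orthoPoly_add_two, binomWeight, Finset.prod_range_succ, gegenCoeff]
    set c := ∏ i ∈ Finset.range n, (τ + i) / ((i : ℝ) + 1)
    rw [mul_smul_comm, smul_sub, smul_sub, smul_smul, smul_smul, smul_smul, smul_smul, smul_smul]
    have := hτ.ne'
    congr 2
    · push_cast
      field_simp
      ring
    · push_cast
      field_simp
      ring

end Jack

end

noncomputable section

namespace Jack

/-! ### Partitions of length at most two -/

/-- The largest part of a partition. -/
def top {d : ℕ} (nu : d.Partition) : ℕ := partialSum nu 1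

lemma top_cases {d : ℕ} (nu : d.Partition) : (nu.parts = 0 ∧ top nu = 0 ∧ d = 0) ∨
    ∃ t : List ℕ, nu.parts = (top nu ::ₘ (t : Multiset ℕ)) ∧ (∀ x ∈ t, x ≤ top nu) ∧
      top nu + t.sum = d ∧ nu.parts.sort (· ≥ ·) = top nu :: t := by
  have h1 : ((nu.parts.sort (· ≥ ·) : List ℕ) : Multiset ℕ) = nu.parts := Multiset.sort_eq _ _
  have h2 := Multiset.pairwise_sort nu.parts (· ≥ ·)
  have h3 := nu.parts_sum
  unfold top partialSum
  revert h1 h2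
  cases nu.parts.sort (· ≥ ·) with
  | nil =>
    intro h1 _
    left
    rw [← h1] at h3 ⊢
    exact ⟨rfl, rfl, h3.symm⟩
  | cons a t =>
    intro h1 h2
    right
    rw [← h1] at h3 ⊢
    refine ⟨t, by simp, ?_, ?_, by simp⟩
    · intro x hx
      simpa using (List.pairwise_cons.mp h2).1 x hx
    · simpa using h3

lemma top_le {d : ℕ} (nu : d.Partition) : top nu ≤ d := by
  rcases top_cases nu with ⟨-, h, -⟩ | ⟨t, -, -, h, -⟩ <;> omega

lemma exists_gprod_parts (τ : ℝ) {d : ℕ} (nu : d.Partition) : ∃ s : Multiset ℕ,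
    gprod τ nu.parts = gfun τ (top nu) * gprod τ s ∧ top nu + s.sum = d := by
  rcases top_cases nu with ⟨h1, h2, h3⟩ | ⟨t, h1, -, h2, -⟩
  · exact ⟨0, by rw [h1, h2, gfun_zero, one_mul], by simp [h2, h3]⟩
  · exact ⟨t, by rw [h1, gprod, gprod, Multiset.map_cons, Multiset.prod_cons], by simpa using h2⟩

lemma two_row {d : ℕ} {nu : d.Partition} (h : nu.parts.card ≤ 2) :
    nu.parts = Multiset.filter (· ≠ 0) {top nu, d - top nu} ∧ d ≤ 2 * top nu := by
  rcases top_cases nu with ⟨h1, h2, h3⟩ | ⟨t, h1, h2, h3, -⟩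
  · subst h3
    rw [h1, h2]
    exact ⟨rfl, le_rfl⟩
  · have hpos : ∀ x ∈ nu.parts, x ≠ 0 := fun x hx => (nu.parts_pos hx).ne'
    rw [h1] at h hpos
    have h4 : top nu ≠ 0 := hpos _ (by simp)
    match t, h1, h2, h3, h, hpos with
    | [], h1, h2, h3, h, hpos =>
      simp only [List.sum_nil, add_zero] at h3
      rw [h1]
      have : d - top nu = 0 := by omega
      rw [this]
      refine ⟨?_, by omega⟩
      rw [Multiset.insert_eq_cons, Multiset.filter_cons_of_pos (p := fun x => x ≠ 0) _ h4]
      simp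
    | [b], h1, h2, h3, h, hpos =>
      simp only [List.sum_singleton] at h3
      have h5 : b ≠ 0 := hpos _ (by simp)
      have h6 := h2 b (by simp)
      rw [h1]
      have : d - top nu = b := by omega
      rw [this]
      refine ⟨?_, by omega⟩
      rw [Multiset.insert_eq_cons, Multiset.filter_cons_of_pos (p := fun x => x ≠ 0) _ h4,
        Multiset.filter_singleton, if_pos h5]
      rfl
    | _ :: _ :: _, h1, h2, h3, h, hpos => simp at h

lemma filter_pair_eq {x y a b : ℕ} :
    Multiset.filter (· ≠ 0) ({x, y} : Multiset ℕ) = Multiset.filter (· ≠ 0) {a, b}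
      ↔ (x = a ∧ y = b) ∨ (x = b ∧ y = a) := by
  constructor
  · intro h
    have hsum := congrArg Multiset.sum h
    rw [sum_filter_ne_zero, sum_filter_ne_zero] at hsum
    simp only [Multiset.insert_eq_cons, Multiset.sum_cons, Multiset.sum_singleton] at hsum
    have hmem : ∀ c, c ∈ Multiset.filter (· ≠ 0) ({x, y} : Multiset ℕ)
        ↔ c ∈ Multiset.filter (· ≠ 0) ({a, b} : Multiset ℕ) := fun c => by rw [h]
    simp only [Multiset.mem_filter, Multiset.insert_eq_cons, Multiset.mem_cons,
      Multiset.mem_singleton] at hmem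
    have ha := hmem a
    have hb := hmem b
    omega
  · rintro (⟨rfl, rfl⟩ | ⟨rfl, rfl⟩)
    · rfl
    · rw [Multiset.pair_comm]

lemma exists_two_row {a b d : ℕ} (hab : a + b = d) (hba : b ≤ a) :
    ∃ nu : d.Partition, nu.parts.card ≤ 2 ∧ top nu = a := by
  obtain ⟨nu, hnu⟩ := exists_partition (d := d) (s := {a, b}) (by simpa using hab)
  have h1 : nu.parts.card ≤ 2 := by
    rw [hnu]
    exact (Multiset.card_le_card (Multiset.filter_le _ _)).trans (by simp)
  refine ⟨nu, h1, ?_⟩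
  have h2 := two_row h1
  have h3 := top_le nu
  rw [hnu, filter_pair_eq] at h2
  omega

lemma two_row_ext {d : ℕ} {lam mu : d.Partition} (h1 : lam.parts.card ≤ 2)
    (h2 : mu.parts.card ≤ 2) (h : top lam = top mu) : lam = mu := by
  ext1
  rw [(two_row h1).1, (two_row h2).1, h]

/-- From the second partial sum on, `lam` already attains the maximal value d, so only the first one
matters, even if `nu` is longer. -/
lemma majorizes_two_row {d : ℕ} {lam nu : d.Partition} (hlam : lam.parts.card ≤ 2) :
    Majorizes lam nu ↔ top nu ≤ top lam := by
  refine ⟨fun h => h 1, fun h k => ?_⟩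
  have hd : ∀ (mu : d.Partition) k, partialSum mu k ≤ d := by
    intro mu k
    have : (mu.parts.sort (· ≥ ·)).sum = d := by
      rw [← Multiset.sum_coe, Multiset.sort_eq, mu.parts_sum]
    unfold partialSum
    conv_rhs => rw [← this]
    exact (List.take_sublist k _).sum_le_sum (by simp)
  match k with
  | 0 => simp [partialSum]
  | 1 => exact h
  | k + 2 =>
    have : partialSum lam (k + 2) = d := by
      unfold partialSum
      rw [List.take_of_length_le, ← Multiset.sum_coe, Multiset.sort_eq, lam.parts_sum]
      rw [Multiset.length_sort]
      omega
    rw [this]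
    exact hd nu _

open Polynomial

/-! ### Two-row Jack symmetric functions -/

lemma coeff_orthoPoly_eq_zero (b : ℕ → ℝ) (m k : ℕ) (h : k % 2 ≠ m % 2) :
    (orthoPoly b m).coeff k = 0 := by
  induction m using Nat.twoStepInduction generalizing k with
  | zero =>
    simp only [orthoPoly, threeTerm_zero, coeff_one]
    rw [if_neg]
    omega
  | one =>
    simp only [orthoPoly, threeTerm_one, coeff_X]
    rw [if_neg]
    omega
  | more m h0 h1 =>
    rw [orthoPoly_add_two, coeff_sub, coeff_smul, h0 k (by omega), smul_zero, sub_zero]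
    cases k with
    | zero => simp
    | succ k => rw [coeff_X_mul, h1 k (by omega)]

/-- The recurrence coefficients of the Chebyshev polynomials. -/
def chebCoeff (m : ℕ) : ℝ := if m = 0 then 2 else 1

/-- The value at m = 0 is 1 and not 2, as for the monomial symmetric polynomial of (a, a); the
exceptional coefficient `chebCoeff 0 = 2` compensates for this. -/
lemma eval_orthoPoly_chebCoeff {z : ℝ} (hz : z ≠ 0) (m : ℕ) :
    (orthoPoly chebCoeff m).eval (z + z⁻¹) = if m = 0 then 1 else z ^ m + z⁻¹ ^ m := by
  induction m using Nat.twoStepInduction with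
  | zero => simp [orthoPoly]
  | one => simp [orthoPoly]
  | more m h0 h1 =>
    rw [orthoPoly_add_two, eval_sub, eval_mul, h1, eval_smul, h0, eval_X,
      if_neg (Nat.succ_ne_zero m), if_neg (Nat.succ_ne_zero (m + 1)), chebCoeff, smul_eq_mul]
    by_cases hm : m = 0
    · subst hm
      rw [if_pos rfl, if_pos rfl]
      linear_combination 2 * mul_inv_cancel₀ hz
    · rw [if_neg hm, if_neg hm]
      linear_combination (z ^ m + z⁻¹ ^ m) * mul_inv_cancel₀ hz

/-- The exponent `(a, b)`. -/
def pairExp (a b : ℕ) : Fin 2 →₀ ℕ := Finsupp.equivFunOnFinite.symm ![a, b]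

@[simp] lemma pairExp_zero (a b : ℕ) : pairExp a b 0 = a := rfl

@[simp] lemma pairExp_one (a b : ℕ) : pairExp a b 1 = b := rfl

/-! ### Monomial symmetric polynomials in two variables -/

lemma map_univ_two (c : Fin 2 →₀ ℕ) :
    (Finset.univ : Finset (Fin 2)).val.map c = {c 0, c 1} := by
  rfl

lemma coeff_msymm_two {d : ℕ} {nu : d.Partition} (h : nu.parts.card ≤ 2) (c : Fin 2 →₀ ℕ) :
    MvPolynomial.coeff c (MvPolynomial.msymm (Fin 2) ℝ nu)
      = if (c 0 = top nu ∧ c 1 = d - top nu) ∨ (c 0 = d - top nu ∧ c 1 = top nu)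
        then 1 else 0 := by
  rw [coeff_msymm, map_univ_two, (two_row h).1]
  simp only [filter_pair_eq]

lemma msymm_two_eq_zero {d : ℕ} {nu : d.Partition} (h : 2 < nu.parts.card) :
    MvPolynomial.msymm (Fin 2) ℝ nu = 0 := by
  ext c
  rw [coeff_msymm, map_univ_two, if_neg, MvPolynomial.coeff_zero]
  intro hc
  have : (Multiset.filter (· ≠ 0) ({c 0, c 1} : Multiset ℕ)).card ≤ 2 :=
    (Multiset.card_le_card (Multiset.filter_le _ _)).trans (by simp)
  rw [hc] at this
  omega

lemma pairExp_eq_iff (a b : ℕ) (c : Fin 2 →₀ ℕ) : pairExp a b = c ↔ c 0 = a ∧ c 1 = b := by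
  constructor
  · rintro rfl
    simp
  · rintro ⟨rfl, rfl⟩
    ext i
    fin_cases i <;> rfl

lemma msymm_two {d : ℕ} {nu : d.Partition} (h : nu.parts.card ≤ 2) :
    MvPolynomial.msymm (Fin 2) ℝ nu = MvPolynomial.monomial (pairExp (top nu) (d - top nu)) 1
      + if 2 * top nu = d then 0
        else MvPolynomial.monomial (pairExp (d - top nu) (top nu)) 1 := by
  classical
  have h2 := (two_row h).2
  ext c
  rw [coeff_msymm_two h, MvPolynomial.coeff_add, MvPolynomial.coeff_monomial]
  have h3 : MvPolynomial.coeff c (if 2 * top nu = d then (0 : MvPolynomial (Fin 2) ℝ)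
      else MvPolynomial.monomial (pairExp (d - top nu) (top nu)) 1)
      = if ¬ (2 * top nu = d) ∧ c 0 = d - top nu ∧ c 1 = top nu then 1 else 0 := by
    split_ifs with h4 h5 h5
    · omega
    · simp
    · rw [MvPolynomial.coeff_monomial, if_pos ((pairExp_eq_iff _ _ _).mpr h5.2)]
    · rw [MvPolynomial.coeff_monomial, if_neg]
      rw [pairExp_eq_iff]
      tauto
  rw [h3]
  simp only [pairExp_eq_iff]
  split_ifs <;> first | omega | norm_num

lemma eval_monomial_pairExp (x : Fin 2 → ℝ) (a b : ℕ) :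
    MvPolynomial.eval x (MvPolynomial.monomial (pairExp a b) 1) = x 0 ^ a * x 1 ^ b := by
  rw [MvPolynomial.eval_monomial, Finsupp.prod_fintype _ _ (by simp), Fin.prod_univ_two, one_mul]
  rfl

/-- With parts a ≥ b the restriction is z^(a-b) + z^(b-a), or 1 if a = b. It is monic of degree a -
b in z + 1/z, so dominance among two-row partitions becomes the order of degrees. -/
lemma restrict_monomialFun {d : ℕ} {nu : d.Partition} (h : nu.parts.card ≤ 2) :
    restrict (monomialFun nu) = orthoPoly chebCoeff (2 * top nu - d) := by
  refine eq_of_eval_add_inv fun z hz => ?_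
  have h2 := (two_row h).2
  have h3 := top_le nu
  rw [eval_restrict hz.ne', toVars_monomialFun, msymm_two h, eval_orthoPoly_chebCoeff hz.ne']
  have key : ∀ a b : ℕ, b ≤ a → z ^ a * z⁻¹ ^ b = z ^ (a - b) := by
    intro a b hab
    conv_lhs => rw [← Nat.sub_add_cancel hab, pow_add, mul_assoc, ← mul_pow,
      mul_inv_cancel₀ hz.ne', one_pow, mul_one]
  have key' : ∀ a b : ℕ, b ≤ a → z ^ b * z⁻¹ ^ a = z⁻¹ ^ (a - b) := by
    intro a b hab
    conv_lhs => rw [← Nat.sub_add_cancel hab, pow_add, mul_comm, mul_assoc, ← mul_pow,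
      inv_mul_cancel₀ hz.ne', one_pow, mul_one]
  have h4 : top nu - (d - top nu) = 2 * top nu - d := by omega
  have e1 := key _ _ (show d - top nu ≤ top nu by omega)
  have e2 := key' _ _ (show d - top nu ≤ top nu by omega)
  rw [h4] at e1 e2
  have h0 : (![z, z⁻¹] : Fin 2 → ℝ) 0 = z := rfl
  have h1 : (![z, z⁻¹] : Fin 2 → ℝ) 1 = z⁻¹ := rfl
  by_cases h5 : 2 * top nu = d
  · rw [if_pos h5, if_pos (by omega), add_zero, eval_monomial_pairExp, h0, h1, e1, h5,
      Nat.sub_self, pow_zero]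
  · rw [if_neg h5, if_neg (by omega), map_add, eval_monomial_pairExp, eval_monomial_pairExp, h0, h1,
      e1, e2]

lemma restrict_monomialFun_eq_zero {d : ℕ} {nu : d.Partition} (h : 2 < nu.parts.card) :
    restrict (monomialFun nu) = 0 := by
  refine eq_of_eval_add_inv fun z hz => ?_
  rw [eval_restrict hz.ne', toVars_monomialFun, msymm_two_eq_zero h]
  simp

lemma natDegree_restrict_gprod {τ : ℝ} (hτ : 0 < τ) (s : Multiset ℕ) :
    (restrict (gprod τ s)).natDegree ≤ s.sum := by
  induction s using Multiset.induction_on with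
  | empty => simp [gprod]
  | cons b s ih =>
    rw [gprod, Multiset.map_cons, Multiset.prod_cons, map_mul, Multiset.sum_cons]
    refine natDegree_mul_le.trans (add_le_add ?_ ih)
    rw [restrict_gfun hτ]
    exact (natDegree_smul_le _ _).trans (natDegree_orthoPoly _ _).le

/-- The Jack expansion of a partition of length at most two, and the value of the Jack symmetric
function at `(z, z⁻¹)`. -/
theorem exists_isJackExpansion {τ : ℝ} (hτ : 0 < τ) {d : ℕ} {lam : d.Partition}
    (hlam : lam.parts.card ≤ 2) : ∃ K, IsJackExpansion τ lam K ∧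
      restrict (∑ nu, K nu • monomialFun nu) = orthoPoly (gegenCoeff τ) (2 * top lam - d) := by
  classical
  obtain ⟨L, hL⟩ := exists_functional (gegenCoeff τ)
  let q := orthoPoly (gegenCoeff τ)
  -- The functional to be represented by a symmetric function: restrict, then take the L-pairing
  -- with q_m.
  let φ : ℕ → SymFun → ℝ := fun m f => L (restrict f * q m)
  have hφ : ∀ m, ∀ c : d.Partition → ℝ, ∀ f : d.Partition → SymFun,
      φ m (∑ nu, c nu • f nu) = ∑ nu, c nu * φ m (f nu) := by
    intro m c f
    simp only [φ, map_sum, Finset.sum_mul, map_smul, smul_mul_assoc, smul_eq_mul]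
  -- By duality these coefficients make `P m` represent `φ m` in degree d; see `hPf`. Partitions
  -- with more than two parts restrict to zero, so they contribute nothing.
  let P : ℕ → SymFun := fun m => ∑ nu : d.Partition,
    (if nu.parts.card ≤ 2 then φ m (monomialFun nu) else 0) • gprod τ nu.parts
  have hP : ∀ m, Homog d (P m) := fun m => Homog.sum fun nu _ => by
    have := homog_gprod τ nu.parts
    rw [nu.parts_sum] at this
    exact this.smul _
  have hPm : ∀ m (mu : d.Partition), hall τ (P m) (monomialFun mu) = φ m (monomialFun mu) := by
    intro m mu
    simp only [P]
    rw [hall_sum_left, Finset.sum_eq_single mu]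
    · rw [hall_smul_left, hall_gprod_parts_monomialFun hτ.ne', if_pos rfl, mul_one]
      split_ifs with h
      · rfl
      · simp only [φ]
        rw [restrict_monomialFun_eq_zero (by omega), zero_mul, map_zero]
    · intro nu _ hne
      rw [hall_smul_left, hall_gprod_parts_monomialFun hτ.ne', if_neg hne, mul_zero]
    · simp
  have hPf : ∀ m f, Homog d f → hall τ (P m) f = φ m f := by
    intro m f hf
    rw [hf.eq_sum hτ, hφ, hall_sum]
    simp only [hall_smul, hPm]
  let K : ℕ → d.Partition → ℝ := fun m nu => φ m (gprod τ nu.parts)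
  have hPK : ∀ m, P m = ∑ nu, K m nu • monomialFun nu := by
    intro m
    conv_lhs => rw [(hP m).eq_sum hτ]
    refine Finset.sum_congr rfl fun nu _ => ?_
    have := homog_gprod τ nu.parts
    rw [nu.parts_sum] at this
    rw [hall_comm, hPf m _ this]
  have hq : ∀ m, (q m).natDegree = m := natDegree_orthoPoly _
  -- Triangularity: the product for `nu` contains a multiple of q_{top nu}, while the other factors
  -- times q_m have degree at most (d - top nu) + (2 top mu - d) < top nu, so L vanishes.
  have hK0 : ∀ mu nu : d.Partition, mu.parts.card ≤ 2 → top mu < top nu →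
      K (2 * top mu - d) nu = 0 := by
    intro mu nu hmu h
    obtain ⟨s, hs, hs'⟩ := exists_gprod_parts τ nu
    have h2 := (two_row hmu).2
    simp only [K, φ]
    rw [hs, map_mul restrict, restrict_gfun hτ, smul_mul_assoc, smul_mul_assoc, map_smul,
      mul_assoc, mul_comm]
    have h3 : (restrict (gprod τ s) * q (2 * top mu - d)).natDegree < top nu := by
      refine lt_of_le_of_lt natDegree_mul_le ?_
      have := natDegree_restrict_gprod hτ s
      rw [hq]
      omega
    rw [hL _ _ h3.le, coeff_eq_zero_of_natDegree_lt h3]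
    simp
  have hdeg : ∀ mu : d.Partition, mu.parts.card ≤ 2 →
      (restrict (P (2 * top mu - d))).natDegree ≤ 2 * top mu - d := by
    intro mu hmu
    rw [hPK, map_sum]
    refine natDegree_sum_le_of_forall_le _ _ fun nu _ => ?_
    rw [map_smul]
    by_cases h1 : top mu < top nu
    · rw [hK0 mu nu hmu h1, zero_smul, natDegree_zero]
      omega
    by_cases h2 : nu.parts.card ≤ 2
    · refine (natDegree_smul_le _ _).trans ?_
      rw [restrict_monomialFun h2, natDegree_orthoPoly]
      omega
    · rw [restrict_monomialFun_eq_zero (by omega), smul_zero, natDegree_zero]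
      omega
  -- Orthogonality to lower terms: they restrict to zero or to polynomials of degree below m.
  have hφ0 : ∀ mu : d.Partition, top mu ≤ top lam → mu ≠ lam →
      φ (2 * top lam - d) (monomialFun mu) = 0 := by
    intro mu h1 h2
    simp only [φ]
    by_cases h3 : mu.parts.card ≤ 2
    · have h4 : top mu ≠ top lam := fun h => h2 (two_row_ext h3 hlam h)
      have h5 := (two_row h3).2
      have h6 : (restrict (monomialFun mu)).natDegree < 2 * top lam - d := by
        rw [restrict_monomialFun h3, natDegree_orthoPoly]
        omega
      rw [hL _ _ h6.le, coeff_eq_zero_of_natDegree_lt h6, zero_mul]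
    · rw [restrict_monomialFun_eq_zero (by omega), zero_mul, map_zero]
  set m := 2 * top lam - d with hm
  have hprod : ∀ n, ∏ j ∈ Finset.range n, gegenCoeff τ j ≠ 0 := fun n =>
    Finset.prod_ne_zero_iff.mpr fun j _ => (gegenCoeff_pos hτ j).ne'
  have hcoeff1 : ∀ n, (orthoPoly chebCoeff n).coeff n = 1 := fun n => by
    have := monic_orthoPoly chebCoeff n
    rwa [Monic, leadingCoeff, natDegree_orthoPoly] at this
  have hφlam : φ m (monomialFun lam) ≠ 0 := by
    simp only [φ]
    rw [restrict_monomialFun hlam, hL _ _ (natDegree_orthoPoly _ _).le, ← hm, hcoeff1, one_mul]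
    exact hprod m
  have hd := (two_row hlam).2
  have hcoeffm : (restrict (P m)).coeff m = K m lam := by
    rw [hPK, map_sum, finsetSum_coeff, Finset.sum_eq_single lam]
    · rw [map_smul, coeff_smul, restrict_monomialFun hlam, ← hm, hcoeff1, smul_eq_mul, mul_one]
    · intro nu _ hnu
      rw [map_smul, coeff_smul]
      by_cases h1 : top lam < top nu
      · rw [hK0 lam nu hlam h1, zero_smul]
      by_cases h2 : nu.parts.card ≤ 2
      · have h4 : top nu ≠ top lam := fun h => hnu (two_row_ext h2 hlam h)
        have h5 := (two_row h2).2
        rw [restrict_monomialFun h2, coeff_eq_zero_of_natDegree_lt, smul_zero]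
        rw [natDegree_orthoPoly]
        omega
      · rw [restrict_monomialFun_eq_zero (by omega), coeff_zero, smul_zero]
    · simp
  have hparity : ∀ k, k % 2 ≠ d % 2 → (restrict (P m)).coeff k = 0 := by
    intro k hk
    rw [hPK, map_sum, finsetSum_coeff]
    refine Finset.sum_eq_zero fun nu _ => ?_
    rw [map_smul, coeff_smul]
    by_cases h2 : nu.parts.card ≤ 2
    · have h5 := (two_row h2).2
      rw [restrict_monomialFun h2, coeff_orthoPoly_eq_zero _ _ _ (by omega), smul_zero]
    · rw [restrict_monomialFun_eq_zero (by omega), coeff_zero, smul_zero]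
  -- If the difference h had leading degree n, then n < m and n ≡ d mod 2. Orthogonality gives L(h
  -- q_n) ≠ 0, whereas the symmetry of ⟨P n, P m⟩ and deg restrict (P n) ≤ n < m force L(h q_n) = 0.
  have hmain : restrict (P m) = K m lam • q m := by
    rw [← sub_eq_zero]
    set h := restrict (P m) - K m lam • q m with hh
    by_contra hne
    set n := h.natDegree with hn
    have hlead : h.coeff n ≠ 0 := by
      rw [hn]
      exact leadingCoeff_ne_zero.mpr hne
    have hqm : (q m).coeff m = 1 := by
      have := monic_orthoPoly (gegenCoeff τ) m
      rwa [Monic, leadingCoeff, natDegree_orthoPoly] at this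
    have hnm : n ≠ m := by
      intro hnm
      apply hlead
      rw [hnm, hh, coeff_sub, hcoeffm, coeff_smul, hqm, smul_eq_mul, mul_one, sub_self]
    have hnle : n ≤ m := by
      refine (natDegree_sub_le _ _).trans (max_le (hdeg lam hlam) ?_)
      exact (natDegree_smul_le _ _).trans (hq m).le
    have hnpar : n % 2 = d % 2 := by
      by_contra hcon
      apply hlead
      rw [hh, coeff_sub, hparity n hcon, coeff_smul,
        coeff_orthoPoly_eq_zero _ _ _ (by omega), smul_zero, sub_zero]
    -- The two-row partition with difference of parts n; the parity of n makes it exist, and `hdeg`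
    -- then applies to `P n`.
    obtain ⟨lam', hlam', htop⟩ := exists_two_row (d := d) (a := (d + n) / 2) (b := (d - n) / 2)
      (by have := top_le lam; omega) (by omega)
    have hn' : 2 * top lam' - d = n := by have := top_le lam; omega
    have h1 : L (h * q n) ≠ 0 := by
      rw [hL _ _ hn.ge]
      exact mul_ne_zero hlead (hprod n)
    apply h1
    have h2 : L (restrict (P m) * q n) = 0 := by
      have h3 : L (restrict (P m) * q n) = hall τ (P n) (P m) := (hPf n _ (hP m)).symm
      rw [h3, hall_comm, hPf m _ (hP n)]
      simp only [φ]
      have h4 := hdeg lam' hlam'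
      rw [hn'] at h4
      rw [hL _ _ (by omega), coeff_eq_zero_of_natDegree_lt (by omega), zero_mul]
    have h3 : L (q m * q n) = 0 := by
      rw [mul_comm, hL _ _ (by rw [hq]; omega), coeff_eq_zero_of_natDegree_lt (by rw [hq]; omega),
        zero_mul]
    rw [hh, sub_mul, map_sub, h2, smul_mul_assoc, map_smul, h3, smul_zero, sub_zero]
  -- Otherwise `P m` restricts to zero and so has norm zero, contradicting its nonzero pairing with
  -- `monomialFun lam`.
  have hKlam : K m lam ≠ 0 := by
    intro h0
    rw [h0, zero_smul] at hmain
    have h1 : P m = 0 := by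
      refine eq_zero_of_hall_self hτ ?_
      rw [hPf m _ (hP m)]
      simp only [φ]
      rw [hmain, zero_mul, map_zero]
    apply hφlam
    rw [← hPm, h1, hall_comm, hall_zero]
  have hsum : ∑ nu, ((K m lam)⁻¹ * K m nu) • monomialFun nu = (K m lam)⁻¹ • P m := by
    rw [hPK, Finset.smul_sum]
    simp only [smul_smul]
  refine ⟨fun nu => (K m lam)⁻¹ * K m nu, ⟨inv_mul_cancel₀ hKlam, ?_, ?_⟩, ?_⟩
  · intro nu hnu
    rw [majorizes_two_row hlam]
    by_contra hcon
    refine hnu ?_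
    change (K m lam)⁻¹ * K m nu = 0
    rw [hK0 lam nu hlam (by omega), mul_zero]
  · intro mu hmaj hne
    rw [hsum, hall_smul_left, hPm, hφ0 mu ((majorizes_two_row hlam).mp hmaj) hne, mul_zero]
  · rw [hsum, map_smul, hmain, smul_smul, inv_mul_cancel₀ hKlam, one_smul]

end Jack

end

noncomputable section

namespace Jack

open MvPolynomial Filter

/-! ### Jack polynomials in two variables -/

/-- The recurrence coefficients `gegenCoeff τ` in terms of `θ = 1 / (1 + τ)`. -/
def thetaCoeff (θ : ℝ) : ℕ → ℝ
  | 0 => 2 * θ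
  | k + 1 => (k + 2) * θ * (2 + (k - 1) * θ) / ((1 + (k + 1) * θ) * (1 + k * θ))

/-- At m = 0 numerator and denominator share a factor τ. Cancelling it is why `thetaCoeff` treats 0
separately, and it removes the singularity at τ = 0. -/
lemma gegenCoeff_eq_thetaCoeff {t : ℝ} (ht : 0 < t) :
    gegenCoeff t = thetaCoeff (1 + t)⁻¹ := by
  funext m
  have h1 : 1 + t ≠ 0 := by positivity
  cases m with
  | zero =>
    have := ht.ne'
    simp only [gegenCoeff, thetaCoeff]
    push_cast
    field_simp
    ring
  | succ k =>
    simp only [gegenCoeff, thetaCoeff]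
    push_cast
    have h2 : (k : ℝ) + 1 + t ≠ 0 := by positivity
    have h3 : (k : ℝ) + 1 + 1 + t ≠ 0 := by positivity
    have h4 : 1 + ((k : ℝ) + 1) * (1 + t)⁻¹ = (k + 1 + 1 + t) / (1 + t) := by
      field_simp
      ring
    have h5 : 1 + (k : ℝ) * (1 + t)⁻¹ = (k + 1 + t) / (1 + t) := by
      field_simp
      ring
    rw [h4, h5]
    field_simp
    ring

lemma continuousAt_thetaCoeff {θ : ℝ} (hθ : 0 ≤ θ) (m : ℕ) :
    ContinuousAt (fun x => thetaCoeff x m) θ := by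
  cases m with
  | zero =>
    simp only [thetaCoeff]
    fun_prop
  | succ k =>
    simp only [thetaCoeff]
    refine ContinuousAt.div (by fun_prop) (by fun_prop) ?_
    positivity

/-- The polynomial which for `b = gegenCoeff τ` is the Jack polynomial in two variables of the
partition `(a, d - a)`. -/
def twoRow (b : ℕ → ℝ) (d a : ℕ) : MvPolynomial (Fin 2) ℝ :=
  (X 0 * X 1) ^ (d - a) * threeTerm b (X 0 + X 1) (X 0 * X 1) (2 * a - d)

lemma isHomogeneous_threeTerm (b : ℕ → ℝ) (m : ℕ) :
    (threeTerm b (X 0 + X 1) (X 0 * X 1) m : MvPolynomial (Fin 2) ℝ).IsHomogeneous m := by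
  have hu : (X 0 + X 1 : MvPolynomial (Fin 2) ℝ).IsHomogeneous 1 :=
    (isHomogeneous_X _ _).add (isHomogeneous_X _ _)
  have hv : (X 0 * X 1 : MvPolynomial (Fin 2) ℝ).IsHomogeneous 2 :=
    (isHomogeneous_X _ _).mul (isHomogeneous_X _ _)
  induction m using Nat.twoStepInduction with
  | zero => simpa using isHomogeneous_one _ _
  | one => simpa using hu
  | more m h0 h1 =>
    rw [threeTerm_add_two]
    have e1 := hu.mul h1
    have e2 := hv.mul h0
    rw [show 1 + (m + 1) = m + 2 by ring] at e1
    rw [show 2 + m = m + 2 by ring] at e2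
    exact e1.sub (Submodule.smul_mem (homogeneousSubmodule (Fin 2) ℝ (m + 2)) _ e2)

lemma isHomogeneous_twoRow (b : ℕ → ℝ) {d a : ℕ} (h1 : a ≤ d) (h2 : d ≤ 2 * a) :
    (twoRow b d a).IsHomogeneous d := by
  have hv : (X 0 * X 1 : MvPolynomial (Fin 2) ℝ).IsHomogeneous 2 :=
    (isHomogeneous_X _ _).mul (isHomogeneous_X _ _)
  have := (hv.pow (d - a)).mul (isHomogeneous_threeTerm b (2 * a - d))
  rwa [show 2 * (d - a) + (2 * a - d) = d by omega] at this

/-! ### From the curve x₀ x₁ = 1 back to two free variables -/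

lemma eval_two_of_homogeneous {d : ℕ} {f : MvPolynomial (Fin 2) ℝ} (hf : f.IsHomogeneous d)
    (r : ℝ) (x : Fin 2 → ℝ) : eval (fun i => r * x i) f = r ^ d * eval x f := by
  rw [eval_eq', eval_eq', Finset.mul_sum]
  refine Finset.sum_congr rfl fun c hc => ?_
  have h1 : c.degree = d := by
    by_contra hcon
    exact (mem_support_iff.mp hc) (hf.coeff_eq_zero hcon)
  simp_rw [mul_pow]
  rw [Finset.prod_mul_distrib, Finset.prod_pow_eq_pow_sum, ← Finsupp.degree_eq_sum, h1]
  ring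

/-- Every point with positive coordinates is √(x₀ x₁) times a point (z, 1/z), and the positive
quadrant determines a polynomial. -/
lemma eq_of_eval_inv {d : ℕ} {f g : MvPolynomial (Fin 2) ℝ} (hf : f.IsHomogeneous d)
    (hg : g.IsHomogeneous d) (h : ∀ z : ℝ, 0 < z → eval ![z, z⁻¹] f = eval ![z, z⁻¹] g) :
    f = g := by
  refine MvPolynomial.funext_set (fun _ => Set.Ioi (0 : ℝ)) (fun _ => Set.Ioi_infinite 0) ?_
  intro x hx
  have h0 : 0 < x 0 := hx 0 trivial
  have h1 : 0 < x 1 := hx 1 trivial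
  set r := √(x 0 * x 1) with hr
  have hr0 : 0 < r := Real.sqrt_pos.mpr (mul_pos h0 h1)
  have hrr : r * r = x 0 * x 1 := Real.mul_self_sqrt (mul_pos h0 h1).le
  have hx' : x = fun i => r * (![x 0 / r, (x 0 / r)⁻¹] : Fin 2 → ℝ) i := by
    funext i
    fin_cases i
    · change x 0 = r * (x 0 / r)
      field_simp
    · change x 1 = r * (x 0 / r)⁻¹
      rw [inv_div]
      field_simp
      linarith
  rw [hx', eval_two_of_homogeneous hf, eval_two_of_homogeneous hg, h _ (div_pos h0 hr0)]

lemma sum_jackCoeffReal {t : ℝ} (ht : 0 < t) {d : ℕ} {lam : d.Partition}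
    (hlam : lam.parts.card ≤ 2) : ∑ nu, jackCoeffReal lam nu t • msymm (Fin 2) ℝ nu
      = twoRow (gegenCoeff t) d (top lam) := by
  obtain ⟨K, hK, h⟩ := exists_isJackExpansion ht hlam
  have h1 : ∑ nu, jackCoeffReal lam nu t • msymm (Fin 2) ℝ nu
      = toVars 2 (∑ nu, K nu • monomialFun nu) := by
    rw [map_sum]
    refine Finset.sum_congr rfl fun nu _ => ?_
    rw [map_smul, toVars_monomialFun, jackCoeffReal_eq ht hK]
  rw [h1]
  refine eq_of_eval_inv (Homog.sum (fun nu _ => (homog_monomialFun nu).smul _) 2)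
    (isHomogeneous_twoRow _ (top_le lam) (two_row hlam).2) fun z hz => ?_
  rw [← eval_restrict hz.ne', h, twoRow, map_mul, map_pow, map_mul, eval_X, eval_X]
  have e0 : (![z, z⁻¹] : Fin 2 → ℝ) 0 = z := rfl
  have e1 : (![z, z⁻¹] : Fin 2 → ℝ) 1 = z⁻¹ := rfl
  rw [e0, e1, mul_inv_cancel₀ hz.ne', one_pow, one_mul, orthoPoly]
  have h2 := map_threeTerm (gegenCoeff t) (Polynomial.X : Polynomial ℝ) 1
    (Polynomial.aeval (z + z⁻¹)) (2 * top lam - d)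
  have h3 := map_threeTerm (gegenCoeff t) (X 0 + X 1 : MvPolynomial (Fin 2) ℝ) (X 0 * X 1)
    (aeval ![z, z⁻¹]) (2 * top lam - d)
  rw [Polynomial.coe_aeval_eq_eval] at h2
  simp only [Polynomial.eval_X, Polynomial.eval_one] at h2
  simp only [aeval_eq_eval, map_add, map_mul, eval_X, e0, e1] at h3
  rw [mul_inv_cancel₀ hz.ne'] at h3
  exact h2.trans h3.symm

/-! ### Limits of coefficients, including τ = 0 and τ = ∞ -/

lemma tendsto_coeff_mul {ι : Type*} {l : Filter ι} (u : MvPolynomial (Fin 2) ℝ)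
    {p : ι → MvPolynomial (Fin 2) ℝ} {q : MvPolynomial (Fin 2) ℝ}
    (h : ∀ c, Tendsto (fun i => coeff c (p i)) l (𝓝 (coeff c q))) (c : Fin 2 →₀ ℕ) :
    Tendsto (fun i => coeff c (u * p i)) l (𝓝 (coeff c (u * q))) := by
  classical
  simp only [coeff_mul]
  exact tendsto_finsetSum _ fun x _ => (h x.2).const_mul _

lemma tendsto_coeff_twoRow {ι : Type*} {l : Filter ι} {b : ι → ℕ → ℝ} {b' : ℕ → ℝ}
    (h : ∀ m, Tendsto (fun i => b i m) l (𝓝 (b' m))) (d a : ℕ) (c : Fin 2 →₀ ℕ) :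
    Tendsto (fun i => coeff c (twoRow (b i) d a)) l (𝓝 (coeff c (twoRow b' d a))) := by
  unfold twoRow
  refine tendsto_coeff_mul _ (fun c => ?_) c
  induction (2 * a - d) using Nat.twoStepInduction generalizing c with
  | zero => simpa using tendsto_const_nhds
  | one => simpa using tendsto_const_nhds
  | more m h0 h1 =>
    simp only [threeTerm_add_two, coeff_sub, coeff_smul, smul_eq_mul]
    exact (tendsto_coeff_mul _ h1 c).sub ((h m).mul (tendsto_coeff_mul _ h0 c))

/-- Isolates a single expansion coefficient, so that convergence of the polynomial yields
convergence of each coefficient that is visible in two variables. -/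
lemma coeff_sum_msymm {d : ℕ} {nu : d.Partition} (h : nu.parts.card ≤ 2)
    (K : d.Partition → ℝ) :
    coeff (pairExp (top nu) (d - top nu)) (∑ mu, K mu • msymm (Fin 2) ℝ mu) = K nu := by
  rw [coeff_sum, Finset.sum_eq_single nu]
  · rw [coeff_smul, coeff_msymm_two h, if_pos (by simp), smul_eq_mul, mul_one]
  · intro mu _ hne
    rw [coeff_smul, coeff_msymm, map_univ_two, pairExp_zero, pairExp_one, ← (two_row h).1,
      if_neg (fun hcon => hne (Nat.Partition.ext hcon.symm)), smul_zero]
  · simp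

/-- The parameter `1 / (1 + τ)` in `[0, 1]`. -/
def theta (τ : ℝ≥0∞) : ℝ := (1 + τ)⁻¹.toReal

lemma theta_nonneg (τ : ℝ≥0∞) : 0 ≤ theta τ := ENNReal.toReal_nonneg

lemma theta_le_one (τ : ℝ≥0∞) : theta τ ≤ 1 := by
  unfold theta
  rw [← ENNReal.toReal_one]
  refine ENNReal.toReal_mono ENNReal.one_ne_top ?_
  rw [ENNReal.inv_le_one]
  exact le_self_add

lemma theta_antitone {σ τ : ℝ≥0∞} (h : σ ≤ τ) : theta τ ≤ theta σ := by
  unfold theta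
  refine ENNReal.toReal_mono ?_ ?_
  · rw [Ne, ENNReal.inv_eq_top]
    simp
  · rw [ENNReal.inv_le_inv]
    gcongr

/-- `jackCoeff lam mu τ` is a limit of the coefficients at real parameters. -/
lemma exists_filter (τ : ℝ≥0∞) : ∃ l : Filter ℝ, l.NeBot ∧ (∀ᶠ t in l, 0 < t) ∧
    Tendsto (fun t : ℝ => (1 + t)⁻¹) l (𝓝 (theta τ)) ∧
    ∀ {d : ℕ} (lam mu : d.Partition) (a : ℝ), Tendsto (jackCoeffReal lam mu) l (𝓝 a) →
      jackCoeff lam mu τ = a := by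
  by_cases h0 : τ = 0
  · refine ⟨𝓝[>] 0, inferInstance, self_mem_nhdsWithin, ?_, ?_⟩
    · have h1 : ContinuousAt (fun t : ℝ => (1 + t)⁻¹) 0 :=
        ContinuousAt.inv₀ (by fun_prop) (by norm_num)
      have h2 : theta τ = (1 + (0 : ℝ))⁻¹ := by simp [h0, theta]
      rw [h2]
      exact h1.tendsto.mono_left nhdsWithin_le_nhds
    · intro d lam mu a ha
      rw [jackCoeff, if_pos h0]
      exact ha.limUnder_eq
  by_cases h1 : τ = ⊤
  · refine ⟨atTop, inferInstance, eventually_gt_atTop 0, ?_, ?_⟩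
    · have h2 : theta τ = 0 := by simp [h1, theta]
      rw [h2]
      exact tendsto_inv_atTop_zero.comp (tendsto_atTop_add_const_left _ _ tendsto_id)
    · intro d lam mu a ha
      rw [jackCoeff, if_neg h0, if_pos h1]
      exact ha.limUnder_eq
  · refine ⟨pure τ.toReal, inferInstance, ?_, ?_, ?_⟩
    · exact ENNReal.toReal_pos h0 h1
    · have h2 : theta τ = (1 + τ.toReal)⁻¹ := by
        rw [theta, ENNReal.toReal_inv, ENNReal.toReal_add ENNReal.one_ne_top h1,
          ENNReal.toReal_one]
      rw [h2]
      exact tendsto_pure_nhds _ _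
    · intro d lam mu a ha
      rw [jackCoeff, if_neg h0, if_neg h1]
      exact tendsto_nhds_unique (tendsto_pure_nhds _ _) ha

/-- The Jack polynomials in two variables. -/
theorem jackPoly_two (τ : ℝ≥0∞) {d : ℕ} {lam : d.Partition} (hlam : lam.parts.card ≤ 2) :
    jackPoly 2 lam τ = twoRow (thetaCoeff (theta τ)) d (top lam) := by
  obtain ⟨l, hl, hpos, htheta, hlim⟩ := exists_filter τ
  have hb : ∀ m, Tendsto (fun t => gegenCoeff t m) l (𝓝 (thetaCoeff (theta τ) m)) := by
    intro m
    refine ((continuousAt_thetaCoeff (theta_nonneg τ) m).tendsto.comp htheta).congr' ?_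
    filter_upwards [hpos] with t ht
    rw [gegenCoeff_eq_thetaCoeff ht]
    rfl
  have hF := tendsto_coeff_twoRow hb d (top lam)
  have hK : ∀ nu : d.Partition, nu.parts.card ≤ 2 →
      Tendsto (jackCoeffReal lam nu) l (𝓝 (jackCoeff lam nu τ)) := by
    intro nu hnu
    have h1 : Tendsto (jackCoeffReal lam nu) l (𝓝 (coeff (pairExp (top nu) (d - top nu))
        (twoRow (thetaCoeff (theta τ)) d (top lam)))) := by
      refine (hF _).congr' ?_
      filter_upwards [hpos] with t ht
      rw [← sum_jackCoeffReal ht hlam, coeff_sum_msymm hnu]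
    rwa [hlim lam nu _ h1]
  ext c
  refine tendsto_nhds_unique ?_ (hF c)
  have h1 : Tendsto (fun t => ∑ nu, jackCoeffReal lam nu t * coeff c (msymm (Fin 2) ℝ nu)) l
      (𝓝 (∑ nu, jackCoeff lam nu τ * coeff c (msymm (Fin 2) ℝ nu))) := by
    refine tendsto_finsetSum _ fun nu _ => ?_
    -- No convergence is needed for longer partitions: their monomial polynomials vanish in two
    -- variables.
    by_cases hnu : nu.parts.card ≤ 2
    · exact (hK nu hnu).mul_const _
    · simp [msymm_two_eq_zero (not_le.mp hnu)]
  have h2 : coeff c (jackPoly 2 lam τ)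
      = ∑ nu, jackCoeff lam nu τ * coeff c (msymm (Fin 2) ℝ nu) := by
    rw [jackPoly, coeff_sum]
    rfl
  rw [h2]
  refine h1.congr' ?_
  filter_upwards [hpos] with t ht
  rw [← sum_jackCoeffReal ht hlam, coeff_sum]
  rfl

end Jack

end

/-! ### Raising the Gegenbauer parameter, and changing it with nonnegative coefficients -/

noncomputable section

namespace Jack

open Finset

/-! ### Contiguity and connection relations -/

/-- The recurrence coefficients `gegenCoeff (τ + 1)` in terms of `θ = 1 / (1 + τ)`. -/
def shiftCoeff (θ : ℝ) (k : ℕ) : ℝ :=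
  (k + 1) * θ * (k * θ + 2) / ((1 + (k + 1) * θ) * (1 + k * θ))

/-- The ratio of the values at `(1, 1)` of the Jack polynomials in degrees `k + 2` and `k`. -/
def ratioCoeff (θ : ℝ) : ℕ → ℝ
  | 0 => 4 - 2 * θ
  | k + 1 => (2 + (k - 1) * θ) * (2 + k * θ) / ((1 + k * θ) * (1 + (k + 1) * θ))

lemma ratioCoeff_pos {θ : ℝ} (h0 : 0 ≤ θ) (h1 : θ ≤ 1) (k : ℕ) : 0 < ratioCoeff θ k := by
  cases k with
  | zero => simp only [ratioCoeff]; linarith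
  | succ k =>
    simp only [ratioCoeff]
    have h2 : 0 < 2 + ((k : ℝ) - 1) * θ := by
      have : 0 ≤ (k : ℝ) * θ := by positivity
      linarith
    positivity

/-- This and `ratioCoeff_mul` are the two coefficient comparisons in the inductive step of
`threeTerm_contiguity`. -/
lemma ratioCoeff_add {θ : ℝ} (h0 : 0 ≤ θ) (m : ℕ) : ratioCoeff θ (m + 1) + shiftCoeff θ m
    = thetaCoeff θ (m + 2) + ratioCoeff θ (m + 2) := by
  simp only [ratioCoeff, shiftCoeff, thetaCoeff]
  push_cast
  have h1 : 1 + (m : ℝ) * θ ≠ 0 := by positivity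
  have h2 : 1 + ((m : ℝ) + 1) * θ ≠ 0 := by positivity
  have h3 : 1 + ((m : ℝ) + 1 + 1) * θ ≠ 0 := by positivity
  field_simp
  ring

lemma ratioCoeff_mul {θ : ℝ} (h0 : 0 ≤ θ) (m : ℕ) :
    shiftCoeff θ m * ratioCoeff θ m = ratioCoeff θ (m + 1) * thetaCoeff θ m := by
  cases m with
  | zero =>
    simp only [ratioCoeff, shiftCoeff, thetaCoeff]
    push_cast
    have h2 : 1 + θ ≠ 0 := by positivity
    simp only [zero_mul, zero_add, zero_sub, one_mul, add_zero, mul_one]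
    field_simp
    ring
  | succ m =>
    simp only [ratioCoeff, shiftCoeff, thetaCoeff]
    push_cast
    have h1 : 1 + (m : ℝ) * θ ≠ 0 := by positivity
    have h2 : 1 + ((m : ℝ) + 1) * θ ≠ 0 := by positivity
    have h3 : 1 + ((m : ℝ) + 1 + 1) * θ ≠ 0 := by positivity
    field_simp
    ring

section

variable {R : Type*} [CommRing R] [Algebra ℝ R] (u v : R)

/-- Both sides obey the recurrence with coefficients `shiftCoeff θ`. For u = x + y and v = xy the
factor u² - 4v is (x - y)²; at (1, 1) it vanishes, which forces the constant `ratioCoeff θ m` to be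
the ratio of values there. -/
lemma threeTerm_contiguity {θ : ℝ} (h0 : 0 ≤ θ) (m : ℕ) :
    threeTerm (thetaCoeff θ) u v (m + 2) - ratioCoeff θ m • (v * threeTerm (thetaCoeff θ) u v m)
      = (u ^ 2 - 4 * v) * threeTerm (shiftCoeff θ) u v m := by
  have h4 : algebraMap ℝ R 4 = 4 := map_ofNat _ 4
  induction m using Nat.twoStepInduction with
  | zero =>
    have e : thetaCoeff θ 0 + ratioCoeff θ 0 = 4 := by
      simp only [thetaCoeff, ratioCoeff]
      ring
    have e' := congrArg (algebraMap ℝ R) e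
    rw [map_add, h4] at e'
    simp only [threeTerm_add_two, threeTerm_zero, zero_add, threeTerm_one, Algebra.smul_def]
    linear_combination (-v) * e'
  | one =>
    have e : thetaCoeff θ 0 + thetaCoeff θ 1 + ratioCoeff θ 1 = 4 := by
      simp only [thetaCoeff, ratioCoeff]
      push_cast
      have h2 : 1 + θ ≠ 0 := by positivity
      simp only [zero_mul, zero_add, zero_sub, one_mul, add_zero]
      field_simp
      ring
    have e' := congrArg (algebraMap ℝ R) e
    rw [map_add, map_add, h4] at e'
    have r0 := threeTerm_add_two (thetaCoeff θ) u v 0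
    have r1 := threeTerm_add_two (thetaCoeff θ) u v 1
    simp only [zero_add, Nat.reduceAdd, threeTerm_zero, threeTerm_one, Algebra.smul_def] at r0 r1 ⊢
    rw [r1, r0]
    linear_combination (-u * v) * e'
  | more m ih0 ih1 =>
    have e1 := congrArg (algebraMap ℝ R) (ratioCoeff_add h0 m)
    have e2 := congrArg (algebraMap ℝ R) (ratioCoeff_mul h0 m)
    rw [map_add, map_add] at e1
    rw [map_mul, map_mul] at e2
    have r1 := threeTerm_add_two (thetaCoeff θ) u v m
    have r2 := threeTerm_add_two (thetaCoeff θ) u v (m + 2)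
    have r3 := threeTerm_add_two (shiftCoeff θ) u v m
    simp only [Algebra.smul_def] at ih0 ih1 r1 r2 r3 ⊢
    rw [r2, r3]
    linear_combination u * ih1 - algebraMap ℝ R (shiftCoeff θ m) * v * ih0
      - v * threeTerm (thetaCoeff θ) u v (m + 2) * e1 * (-1)
      + v ^ 2 * threeTerm (thetaCoeff θ) u v m * e2 * (-1)
      + algebraMap ℝ R (ratioCoeff θ (m + 1)) * v * r1 * (-1)

end

/-- The product `(1 + s x) (1 + (s + 1) x) ⋯ (1 + (s + j - 1) x)`. -/
def risingProd (x : ℝ) (s j : ℕ) : ℝ := ∏ i ∈ range j, (1 + ((s : ℝ) + i) * x)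

lemma risingProd_pos {x : ℝ} (hx : 0 ≤ x) (s j : ℕ) : 0 < risingProd x s j :=
  prod_pos fun i _ => by positivity

lemma risingProd_succ (x : ℝ) (s j : ℕ) :
    risingProd x s (j + 1) = risingProd x s j * (1 + ((s : ℝ) + j) * x) :=
  prod_range_succ _ _

lemma risingProd_succ' (x : ℝ) (s j : ℕ) :
    risingProd x s (j + 1) = (1 + (s : ℝ) * x) * risingProd x (s + 1) j := by
  rw [risingProd, prod_range_succ', mul_comm, risingProd]
  congr 1
  · simp
  · refine prod_congr rfl fun i _ => ?_
    push_cast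
    ring

/-- The connection coefficients between Gegenbauer polynomials. -/
def connCoeff (θ η : ℝ) (n j : ℕ) : ℝ :=
  ((n + 2 * j).factorial : ℝ) / (j.factorial * n.factorial)
    * (∏ i ∈ range j, (η - θ + i * θ * η)) / (risingProd θ (n + j) j * risingProd η (n + 1) j)

/-- For θ = 1/(1+τ) and η = 1/(1+σ) with finite parameters, η - θ + iθη = θη(τ - σ + i). This is
where σ ≤ τ enters. -/
lemma connCoeff_nonneg {θ η : ℝ} (h0 : 0 ≤ θ) (h : θ ≤ η) (n j : ℕ) : 0 ≤ connCoeff θ η n j := by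
  have h1 := risingProd_pos h0 (n + j) j
  have h2 := risingProd_pos (h0.trans h) (n + 1) j
  have h3 : 0 ≤ ∏ i ∈ range j, (η - θ + i * θ * η) := by
    refine prod_nonneg fun i _ => ?_
    have h4 : 0 ≤ η := h0.trans h
    have : 0 ≤ (i : ℝ) * θ * η := by positivity
    linarith
  unfold connCoeff
  positivity

@[simp] lemma connCoeff_zero (θ η : ℝ) (n : ℕ) : connCoeff θ η n 0 = 1 := by
  have : (n.factorial : ℝ) ≠ 0 := by positivity
  simp [connCoeff, risingProd, this]

/-- Comparison of the coefficients of v^(j+1) Q_n in the three-term recurrence for Q_{n+2j+2} at θ,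
where u times each term is rewritten by the recurrence at η. -/
lemma connCoeff_rec {θ η : ℝ} (h0 : 0 ≤ θ) (h1 : 0 ≤ η) (n j : ℕ) :
    connCoeff θ η n (j + 1) = (if n = 0 then 0 else connCoeff θ η (n - 1) (j + 1))
      + (shiftCoeff η n * connCoeff θ η (n + 1) j
        - shiftCoeff θ (n + 2 * j) * connCoeff θ η n j) := by
  set A := ∏ i ∈ range j, (η - θ + i * θ * η) with hA
  set C := risingProd θ (n + j + 1) j with hC
  set E := risingProd η (n + 1) j with hE
  set F : ℝ := ((n + 2 * j).factorial : ℝ) / (j.factorial * n.factorial) with hF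
  have hCpos : 0 < C := risingProd_pos h0 _ _
  have hEpos : 0 < E := risingProd_pos h1 _ _
  have p1 : 0 < 1 + ((n : ℝ) + j) * θ := by positivity
  have p2 : 0 < 1 + ((n : ℝ) + 2 * j) * θ := by positivity
  have p3 : 0 < 1 + ((n : ℝ) + 2 * j + 1) * θ := by positivity
  have p4 : 0 < 1 + (n : ℝ) * η := by positivity
  have p5 : 0 < 1 + ((n : ℝ) + 1) * η := by positivity
  have p6 : 0 < 1 + ((n : ℝ) + j + 1) * η := by positivity
  have f1 : (j.factorial : ℝ) ≠ 0 := by positivity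
  have f2 : (n.factorial : ℝ) ≠ 0 := by positivity
  have e1 : connCoeff θ η n j = F * A * (1 + ((n : ℝ) + 2 * j) * θ)
      / ((1 + ((n : ℝ) + j) * θ) * C * E) := by
    have h := risingProd_succ θ (n + j) j
    rw [risingProd_succ'] at h
    push_cast at h
    rw [← hC] at h
    have hp := risingProd_pos h0 (n + j) j
    rw [connCoeff, ← hF, ← hA, ← hE, div_eq_div_iff (by positivity) (by positivity)]
    linear_combination F * A * E * h
  have e2 : connCoeff θ η n (j + 1) = F * ((n + 2 * j + 1) * (n + 2 * j + 2) / (j + 1))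
      * (A * (η - θ + j * θ * η))
      / (C * (1 + ((n : ℝ) + 2 * j + 1) * θ) * (E * (1 + ((n : ℝ) + j + 1) * η))) := by
    have q1 : ((n + 2 * (j + 1)).factorial : ℝ)
        = (n + 2 * j + 2) * ((n + 2 * j + 1) * (n + 2 * j).factorial) := by
      rw [show n + 2 * (j + 1) = n + 2 * j + 1 + 1 by ring, Nat.factorial_succ, Nat.factorial_succ]
      push_cast
      ring
    have q2 : ((j + 1).factorial : ℝ) = (j + 1) * j.factorial := by
      rw [Nat.factorial_succ]
      push_cast
      ring
    have q3 : risingProd θ (n + (j + 1)) (j + 1) = C * (1 + ((n : ℝ) + 2 * j + 1) * θ) := by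
      rw [risingProd_succ, ← add_assoc, ← hC]
      push_cast
      ring
    have q4 : risingProd η (n + 1) (j + 1) = E * (1 + ((n : ℝ) + j + 1) * η) := by
      rw [risingProd_succ, ← hE]
      push_cast
      ring
    rw [connCoeff, q1, q2, q3, q4, prod_range_succ, ← hA, hF]
    congr 2
    field_simp
  have e3 : connCoeff θ η (n + 1) j = F * ((n + 2 * j + 1) / (n + 1)) * A * (1 + ((n : ℝ) + 1) * η)
      / (C * (E * (1 + ((n : ℝ) + j + 1) * η))) := by
    have q1 : ((n + 1 + 2 * j).factorial : ℝ) = (n + 2 * j + 1) * (n + 2 * j).factorial := by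
      rw [show n + 1 + 2 * j = n + 2 * j + 1 by ring, Nat.factorial_succ]
      push_cast
      ring
    have q2 : ((n + 1).factorial : ℝ) = (n + 1) * n.factorial := by
      rw [Nat.factorial_succ]
      push_cast
      ring
    have q3 : risingProd θ (n + 1 + j) j = C := by
      rw [hC]
      congr 1
      ring
    have h := risingProd_succ η (n + 1) j
    rw [risingProd_succ'] at h
    push_cast at h
    rw [← hE] at h
    have hp := risingProd_pos h1 (n + 1 + 1) j
    have q4 : ((n + 2 * j + 1) * (n + 2 * j).factorial : ℝ) / (j.factorial * ((n + 1) * n.factorial))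
        = F * ((n + 2 * j + 1) / (n + 1)) := by
      rw [hF]
      field_simp
    rw [connCoeff, q1, q2, q3, ← hA, q4, div_eq_div_iff (by positivity) (by positivity)]
    linear_combination (-1) * F * ((n + 2 * j + 1) / (n + 1)) * A * C * h
  have e4 : (if n = 0 then 0 else connCoeff θ η (n - 1) (j + 1))
      = F * ((n + 2 * j + 1) * n / (j + 1)) * (A * (η - θ + j * θ * η))
        / ((1 + ((n : ℝ) + j) * θ) * C * ((1 + (n : ℝ) * η) * E)) := by
    cases n with
    | zero => simp
    | succ n =>
      rw [if_neg (Nat.succ_ne_zero n), Nat.add_sub_cancel]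
      have q1 : ((n + 2 * (j + 1)).factorial : ℝ)
          = (n + 1 + 2 * j + 1) * (n + 1 + 2 * j).factorial := by
        rw [show n + 2 * (j + 1) = n + 1 + 2 * j + 1 by ring, Nat.factorial_succ]
        push_cast
        ring
      have q2 : ((j + 1).factorial : ℝ) = (j + 1) * j.factorial := by
        rw [Nat.factorial_succ]
        push_cast
        ring
      have q3 : risingProd θ (n + (j + 1)) (j + 1) = (1 + ((n : ℝ) + 1 + j) * θ) * C := by
        rw [risingProd_succ', hC, show n + (j + 1) = n + 1 + j by ring]
        push_cast
        ring
      have q4 : risingProd η (n + 1) (j + 1) = (1 + ((n : ℝ) + 1) * η) * E := by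
        rw [risingProd_succ', ← hE]
        push_cast
        ring
      have q5 : ((n + 1).factorial : ℝ) = (n + 1) * n.factorial := by
        rw [Nat.factorial_succ]
        push_cast
        ring
      have f3 : (n.factorial : ℝ) ≠ 0 := by positivity
      rw [connCoeff, q1, q2, q3, q4, prod_range_succ, ← hA, hF, q5]
      push_cast
      congr 2
      field_simp
  rw [e1, e2, e3, e4, shiftCoeff, shiftCoeff]
  push_cast
  clear_value A C E F
  clear e1 e2 e3 e4 hA hC hE hF f1 f2
  -- What remains after dividing by the common factor F A (n + 2j + 1) / (C E): an identity of
  -- rational functions in n, j, θ, η.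
  have key : ((n : ℝ) + 2 * j + 2) * (η - θ + j * θ * η)
        / ((j + 1) * (1 + ((n : ℝ) + 2 * j + 1) * θ) * (1 + ((n : ℝ) + j + 1) * η))
      = n * (η - θ + j * θ * η) / ((j + 1) * (1 + ((n : ℝ) + j) * θ) * (1 + (n : ℝ) * η))
        + (η * (n * η + 2) / ((1 + (n : ℝ) * η) * (1 + ((n : ℝ) + j + 1) * η))
        - θ * ((n + 2 * j) * θ + 2)
          / ((1 + ((n : ℝ) + 2 * j + 1) * θ) * (1 + ((n : ℝ) + j) * θ))) := by
    field_simp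
    ring
  have t1 : F * ((n + 2 * j + 1) * (n + 2 * j + 2) / (j + 1)) * (A * (η - θ + j * θ * η))
      / (C * (1 + ((n : ℝ) + 2 * j + 1) * θ) * (E * (1 + ((n : ℝ) + j + 1) * η)))
      = F * A / (C * E) * (n + 2 * j + 1) * (((n : ℝ) + 2 * j + 2) * (η - θ + j * θ * η)
        / ((j + 1) * (1 + ((n : ℝ) + 2 * j + 1) * θ) * (1 + ((n : ℝ) + j + 1) * η))) := by
    field_simp
  rw [t1, key]
  field_simp

section

variable {R : Type*} [CommRing R] [Algebra ℝ R] (u v : R)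

/-- The connection relation between Gegenbauer polynomials. -/
lemma threeTerm_connection {θ η : ℝ} (h0 : 0 ≤ θ) (h1 : 0 ≤ η) (m : ℕ) :
    threeTerm (shiftCoeff θ) u v m = ∑ j ∈ range (m + 1),
      (if 2 * j ≤ m then connCoeff θ η (m - 2 * j) j else 0)
        • (v ^ j * threeTerm (shiftCoeff η) u v (m - 2 * j)) := by
  let e : ℕ → ℕ → ℝ := fun m j => if 2 * j ≤ m then connCoeff θ η (m - 2 * j) j else 0
  let T : ℕ → ℕ → R := fun m j => v ^ j * threeTerm (shiftCoeff η) u v (m - 2 * j)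
  change _ = ∑ j ∈ range (m + 1), e m j • T m j
  have hext : ∀ m, ∑ j ∈ range (m + 2), e m j • T m j = ∑ j ∈ range (m + 1), e m j • T m j := by
    intro m
    rw [sum_range_succ]
    simp only [e]
    rw [if_neg (by omega), zero_smul, add_zero]
  have he : ∀ m j, e (m + 2) (j + 1) = e (m + 1) (j + 1)
      + if 2 * j ≤ m then (shiftCoeff η (m - 2 * j) * e (m + 1) j - shiftCoeff θ m * e m j)
        else 0 := by
    intro m j
    simp only [e]
    by_cases h : 2 * j ≤ m
    · obtain ⟨n, rfl⟩ : ∃ n, m = n + 2 * j := ⟨m - 2 * j, by omega⟩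
      rw [if_pos (show 2 * (j + 1) ≤ n + 2 * j + 2 by omega), if_pos h, if_pos h,
        if_pos (show 2 * j ≤ n + 2 * j + 1 by omega),
        show n + 2 * j + 2 - 2 * (j + 1) = n by omega, show n + 2 * j - 2 * j = n by omega,
        show n + 2 * j + 1 - 2 * j = n + 1 by omega, connCoeff_rec h0 h1]
      congr 1
      by_cases hn : n = 0
      · rw [if_pos hn, if_neg (by omega)]
      · rw [if_neg hn, if_pos (by omega)]
        congr 1
        omega
    · rw [if_neg (by omega), if_neg h, if_neg (by omega), add_zero]
  -- Multiplication by u through the recurrence at η. For 2j = m + 1 the polynomial has degree 0 and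
  -- no lower term arises.
  have hT : ∀ m j, e (m + 1) j • (u * T (m + 1) j) = e (m + 1) j • T (m + 2) j
      + (if 2 * j ≤ m then shiftCoeff η (m - 2 * j) * e (m + 1) j else 0)
        • T (m + 2) (j + 1) := by
    intro m j
    by_cases h : 2 * j ≤ m
    · obtain ⟨n, rfl⟩ : ∃ n, m = n + 2 * j := ⟨m - 2 * j, by omega⟩
      rw [if_pos h]
      simp only [T]
      rw [show n + 2 * j + 2 - 2 * (j + 1) = n by omega, show n + 2 * j - 2 * j = n by omega,
        show n + 2 * j + 1 - 2 * j = n + 1 by omega, show n + 2 * j + 2 - 2 * j = n + 2 by omega,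
        threeTerm_add_two]
      simp only [Algebra.smul_def, map_mul]
      ring
    · rw [if_neg h, zero_smul, add_zero]
      by_cases h' : 2 * j = m + 1
      · simp only [T]
        rw [show m + 1 - 2 * j = 0 by omega, show m + 2 - 2 * j = 1 by omega, threeTerm_zero,
          threeTerm_one, mul_one, mul_comm]
      · have : e (m + 1) j = 0 := if_neg (by omega)
        rw [this, zero_smul, zero_smul]
  have hT' : ∀ m j, e m j • (v * T m j) = e m j • T (m + 2) (j + 1) := by
    intro m j
    simp only [T]
    rw [show m + 2 - 2 * (j + 1) = m - 2 * j by omega]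
    ring_nf
  induction m using Nat.twoStepInduction with
  | zero => simp [e, T]
  | one => simp [e, T, sum_range_succ]
  | more m ih0 ih1 =>
    rw [threeTerm_add_two, ih0, ih1, ← hext m, mul_sum, mul_sum]
    simp only [mul_smul_comm, hT, hT']
    rw [sum_add_distrib, smul_sum]
    have h2 : ∑ j ∈ range (m + 2), e (m + 1) j • T (m + 2) j = e (m + 2) 0 • T (m + 2) 0
        + ∑ j ∈ range (m + 2), e (m + 1) (j + 1) • T (m + 2) (j + 1) := by
      rw [sum_range_succ', sum_range_succ _ (m + 1)]
      have h3 : e (m + 1) (m + 1 + 1) = 0 := if_neg (by omega)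
      have h4 : e (m + 1) 0 = e (m + 2) 0 := by simp [e]
      rw [h3, h4, zero_smul, add_zero, add_comm]
    rw [h2, sum_range_succ' (fun j => e (m + 2) j • T (m + 2) j) (m + 2), add_comm _ (e (m + 2) 0 • _),
      add_assoc, add_sub_assoc, ← sum_add_distrib, ← sum_sub_distrib]
    congr 1
    refine sum_congr rfl fun j _ => ?_
    rw [he, smul_smul, ← add_smul, ← sub_smul]
    congr 1
    by_cases h : 2 * j ≤ m
    · rw [if_pos h, if_pos h]
      ring
    · have h5 : e m j = 0 := if_neg h
      rw [if_neg h, if_neg h, h5]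
      ring

end

end Jack

end

noncomputable section

namespace Jack

open MvPolynomial Finset

/-! ### The Jack cone in two variables -/

/-- The value at `(1, 1)` of the Jack polynomial of degree `m` with `θ = 1 / (1 + τ)`. -/
def valueOne (θ : ℝ) (m : ℕ) : ℝ := threeTerm (thetaCoeff θ) (2 : ℝ) 1 m

/-- The contiguity relation at u = 2, v = 1, where u² - 4v = 0. -/
lemma valueOne_add_two {θ : ℝ} (h0 : 0 ≤ θ) (m : ℕ) :
    valueOne θ (m + 2) = ratioCoeff θ m * valueOne θ m := by
  have h := threeTerm_contiguity (2 : ℝ) 1 h0 m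
  norm_num [smul_eq_mul] at h
  simp only [valueOne]
  linarith

lemma valueOne_pos {θ : ℝ} (h0 : 0 ≤ θ) (h1 : θ ≤ 1) (m : ℕ) : 0 < valueOne θ m := by
  induction m using Nat.twoStepInduction with
  | zero => simp [valueOne]
  | one => simp [valueOne]
  | more m ih0 _ =>
    rw [valueOne_add_two h0]
    exact mul_pos (ratioCoeff_pos h0 h1 m) ih0

lemma eval_one_twoRow (b : ℕ → ℝ) (d a : ℕ) :
    eval (fun _ => (1 : ℝ)) (twoRow b d a) = threeTerm b (2 : ℝ) 1 (2 * a - d) := by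
  have h := map_threeTerm b (X 0 + X 1 : MvPolynomial (Fin 2) ℝ) (X 0 * X 1)
    (aeval fun _ => (1 : ℝ)) (2 * a - d)
  simp only [aeval_eq_eval, map_add, map_mul, eval_X] at h
  rw [twoRow, map_mul, map_pow, map_mul, eval_X, eval_X, one_mul, one_pow, one_mul]
  refine h.trans ?_
  norm_num

lemma normJack_two (τ : ℝ≥0∞) {d : ℕ} {lam : d.Partition} (hlam : lam.parts.card ≤ 2) :
    normJack 2 lam τ = (valueOne (theta τ) (2 * top lam - d))⁻¹
      • twoRow (thetaCoeff (theta τ)) d (top lam) := by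
  rw [normJack, jackPoly_two τ hlam, eval_one_twoRow]
  rfl

/-- A difference of neighbouring normalized Jack polynomials in two variables. -/
lemma jackDiff_two (τ : ℝ≥0∞) {d m k : ℕ} (hd : m + 2 + 2 * k = d) {lam mu : d.Partition}
    (hlam : lam.parts.card ≤ 2) (hmu : mu.parts.card ≤ 2) (h1 : top lam = m + 2 + k)
    (h2 : top mu = m + 1 + k) : jackDiff 2 lam mu τ = (valueOne (theta τ) (m + 2))⁻¹ •
      ((X 0 * X 1) ^ k * (((X 0 + X 1) ^ 2 - 4 * (X 0 * X 1))
        * threeTerm (shiftCoeff (theta τ)) (X 0 + X 1) (X 0 * X 1) m)) := by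
  have hv := (valueOne_pos (theta_nonneg τ) (theta_le_one τ) m).ne'
  have hr := (ratioCoeff_pos (theta_nonneg τ) (theta_le_one τ) m).ne'
  rw [jackDiff, normJack_two τ hlam, normJack_two τ hmu, h1, h2, twoRow, twoRow,
    show 2 * (m + 2 + k) - d = m + 2 by omega, show 2 * (m + 1 + k) - d = m by omega,
    show d - (m + 2 + k) = k by omega, show d - (m + 1 + k) = k + 1 by omega,
    ← threeTerm_contiguity _ _ (theta_nonneg τ)]
  have h3 : (valueOne (theta τ) m)⁻¹
      = (valueOne (theta τ) (m + 2))⁻¹ * ratioCoeff (theta τ) m := by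
    rw [valueOne_add_two (theta_nonneg τ)]
    field_simp
  rw [h3, mul_smul, ← smul_sub, mul_sub, mul_smul_comm, pow_succ, mul_assoc]

lemma smul_mem_jackCone {n : ℕ} {σ : ℝ≥0∞} {c : ℝ} (hc : 0 ≤ c) {f : MvPolynomial (Fin n) ℝ}
    (hf : f ∈ jackCone n σ) : c • f ∈ jackCone n σ :=
  (jackCone n σ).smul_mem (⟨c, hc⟩ : ℝ≥0) hf

lemma jackDiff_mem_jackCone {n : ℕ} (σ : ℝ≥0∞) {d : ℕ} {lam mu : d.Partition}
    (hlam : lam.parts.card ≤ n) (hmu : mu.parts.card ≤ n) (h : Majorizes lam mu) :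
    jackDiff n lam mu σ ∈ jackCone n σ :=
  Submodule.subset_span ⟨d, lam, mu, hlam, hmu, h, rfl⟩

/-- A positive multiple of the difference of (m + 2 + k, k) and (m + 1 + k, k + 1). These are the
generators that occur in the connection formula. -/
lemma neighbour_mem_jackCone (σ : ℝ≥0∞) (m k : ℕ) :
    (X 0 * X 1) ^ k * (((X 0 + X 1) ^ 2 - 4 * (X 0 * X 1))
        * threeTerm (shiftCoeff (theta σ)) (X 0 + X 1) (X 0 * X 1) m) ∈ jackCone 2 σ := by
  obtain ⟨lam, hlam, h1⟩ := exists_two_row (a := m + 2 + k) (b := k) (d := m + 2 + 2 * k)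
    (by ring) (by omega)
  obtain ⟨mu, hmu, h2⟩ := exists_two_row (a := m + 1 + k) (b := k + 1) (d := m + 2 + 2 * k)
    (by ring) (by omega)
  have hmem := jackDiff_mem_jackCone σ hlam hmu ((majorizes_two_row hlam).mpr (by omega))
  have hv := valueOne_pos (theta_nonneg σ) (theta_le_one σ) (m + 2)
  have h3 := smul_mem_jackCone hv.le hmem
  rwa [jackDiff_two σ rfl hlam hmu h1 h2, smul_smul, mul_inv_cancel₀ hv.ne', one_smul] at h3

/-- The connection formula only trades degree for powers of xy, so every term is a neighbour
difference at σ in the same total degree, with nonnegative coefficient. -/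
lemma neighbour_jackDiff_mem {σ τ : ℝ≥0∞} (h : σ ≤ τ) {d : ℕ} {lam mu : d.Partition}
    (hlam : lam.parts.card ≤ 2) (hmu : mu.parts.card ≤ 2) (htop : top lam = top mu + 1) :
    jackDiff 2 lam mu τ ∈ jackCone 2 σ := by
  have e1 := two_row hlam
  have e2 := two_row hmu
  have e3 := top_le lam
  have hd : 2 * top mu - d + 2 + 2 * (d - top lam) = d := by omega
  rw [jackDiff_two τ hd hlam hmu (by omega) (by omega)]
  refine smul_mem_jackCone
    (inv_nonneg.mpr (valueOne_pos (theta_nonneg τ) (theta_le_one τ) _).le) ?_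
  rw [threeTerm_connection _ _ (theta_nonneg τ) (theta_nonneg σ), Finset.mul_sum, Finset.mul_sum]
  refine Submodule.sum_mem _ fun j hj => ?_
  rw [mul_smul_comm, mul_smul_comm]
  split_ifs with h2
  · refine smul_mem_jackCone (connCoeff_nonneg (theta_nonneg τ) (theta_antitone h) _ _) ?_
    have h3 := neighbour_mem_jackCone σ (2 * top mu - d - 2 * j) (d - top lam + j)
    rw [pow_add] at h3
    convert h3 using 1
    ring
  · rw [zero_smul]
    exact Submodule.zero_mem _

theorem jackDiff_two_mem {σ τ : ℝ≥0∞} (h : σ ≤ τ) {d : ℕ} {lam mu : d.Partition}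
    (hlam : lam.parts.card ≤ 2) (hmu : mu.parts.card ≤ 2) (hmaj : Majorizes lam mu) :
    jackDiff 2 lam mu τ ∈ jackCone 2 σ := by
  rw [majorizes_two_row hlam] at hmaj
  obtain ⟨r, hr⟩ := Nat.exists_eq_add_of_le hmaj
  induction r generalizing lam with
  | zero =>
    rw [two_row_ext hlam hmu (by omega), jackDiff, sub_self]
    exact Submodule.zero_mem _
  | succ r ih =>
    have e1 := two_row hlam
    have e2 := two_row hmu
    have e3 := top_le lam
    -- Moving one box down gives a neighbour of `lam` that still majorizes `mu`; the difference
    -- telescopes.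
    obtain ⟨nu, hnu, htop⟩ := exists_two_row (d := d) (a := top lam - 1) (b := d - top lam + 1)
      (by omega) (by omega)
    have h1 := ih hnu (by omega) (by omega)
    have h2 := neighbour_jackDiff_mem h hlam hnu (by omega)
    have h3 : jackDiff 2 lam mu τ = jackDiff 2 lam nu τ + jackDiff 2 nu mu τ := by
      simp only [jackDiff]
      ring
    rw [h3]
    exact Submodule.add_mem _ h2 h1

end Jack

end

/-! ### Second part: elementary symmetric functions and their norms -/

noncomputable section

namespace Jack

open MvPolynomial Finset

/-! ### Elementary symmetric functions -/

/-- The elementary symmetric function in `Λ`. -/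
def elemFun (n : ℕ) : SymFun := (-1 : ℝ) ^ n • gfun (-1) n

/-- At c = -1 the generating series is ∏ (1 - x_i t), and the recursion is Newton's identity. -/
lemma toVars_gfun_neg_one (N n : ℕ) :
    toVars N (gfun (-1) n) = (-1) ^ n * esymm (Fin N) ℝ n := by
  induction n using Nat.strong_induction_on with
  | _ n ih =>
  rcases Nat.eq_zero_or_pos n with rfl | hn
  · simp
  have h := congrArg (toVars N) (natCast_smul_gfun (-1) n)
  rw [map_smul, map_smul, map_sum] at h
  have h1 := mul_esymm_eq_sum (Fin N) ℝ n
  have h2 : ∑ a ∈ antidiagonal n with a.1 < n,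
        (-1) ^ a.1 * esymm (Fin N) ℝ a.1 * psum (Fin N) ℝ a.2
      = ∑ i ∈ range n, toVars N (X (Nat.succPNat (n - 1 - i)) * gfun (-1) i) := by
    rw [sum_filter, Nat.sum_antidiagonal_eq_sum_range_succ_mk, sum_range_succ, if_neg (by simp),
      add_zero]
    refine sum_congr rfl fun i hi => ?_
    have hi' := mem_range.mp hi
    rw [if_pos hi', map_mul, toVars_X, ih i hi', Nat.succPNat_coe,
      show (n - 1 - i).succ = n - i by omega]
    ring
  rw [h2] at h1
  have hn' : (n : ℝ) ≠ 0 := by positivity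
  refine smul_right_injective _ hn' ?_
  change (n : ℝ) • _ = (n : ℝ) • _
  rw [h, smul_eq_C_mul, smul_eq_C_mul, map_natCast, C_neg, C_1]
  have h3 : ((-1 : MvPolynomial (Fin N) ℝ) ^ n) * (-1) ^ n = 1 := by
    rw [← mul_pow]
    simp
  linear_combination (-1) ^ n * h1 * (-1)
    + (∑ i ∈ range n, toVars N (X (Nat.succPNat (n - 1 - i)) * gfun (-1) i)) * h3

lemma toVars_elemFun (N n : ℕ) : toVars N (elemFun n) = esymm (Fin N) ℝ n := by
  rw [elemFun, map_smul, toVars_gfun_neg_one, smul_eq_C_mul, C_pow, C_neg, C_1, ← mul_assoc,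
    ← mul_pow]
  simp

lemma coeff_esymm {N : ℕ} (n : ℕ) (a : Fin N →₀ ℕ) :
    coeff a (esymm (Fin N) ℝ n) = if (∀ i, a i ≤ 1) ∧ ∑ i, a i = n then 1 else 0 := by
  classical
  rw [esymm_eq_sum_monomial, coeff_sum]
  simp only [coeff_monomial]
  have hind : ∀ (t : Finset (Fin N)) j, (∑ i ∈ t, Finsupp.single i 1 : Fin N →₀ ℕ) j
      = if j ∈ t then 1 else 0 := by
    intro t j
    rw [Finsupp.finsetSum_apply]
    simp [Finsupp.single_apply]
  split_ifs with h
  · rw [sum_eq_single a.support]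
    · rw [if_pos]
      ext j
      rw [hind]
      have := h.1 j
      split_ifs with hj
      · have := Finsupp.mem_support_iff.mp hj
        omega
      · exact (Finsupp.notMem_support_iff.mp hj).symm
    · intro t _ ht
      rw [if_neg]
      rintro rfl
      apply ht
      ext j
      rw [Finsupp.mem_support_iff, hind]
      simp
    · intro hcon
      exfalso
      apply hcon
      rw [mem_powersetCard]
      refine ⟨subset_univ _, ?_⟩
      rw [← h.2, card_eq_sum_ones]
      rw [← sum_subset (subset_univ a.support) (fun i _ hi => Finsupp.notMem_support_iff.mp hi)]
      refine sum_congr rfl fun i hi => ?_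
      have := Finsupp.mem_support_iff.mp hi
      have := h.1 i
      omega
  · refine sum_eq_zero fun t ht => if_neg ?_
    rintro rfl
    apply h
    constructor
    · intro i
      rw [hind]
      split_ifs <;> omega
    · simp only [hind]
      simpa using (mem_powersetCard.mp ht).2

lemma filter_eq_replicate_iff {N n : ℕ} (a : Fin N →₀ ℕ) :
    (univ.val.map a).filter (· ≠ 0) = Multiset.replicate n 1
      ↔ (∀ i, a i ≤ 1) ∧ ∑ i, a i = n := by
  have hmem : ∀ i, a i ≠ 0 → a i ∈ (univ.val.map a).filter (· ≠ 0) := fun i hi =>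
    Multiset.mem_filter.mpr ⟨Multiset.mem_map_of_mem _ (mem_univ i), hi⟩
  have hsum : ((univ.val.map a).filter (· ≠ 0)).sum = ∑ i, a i := sum_filter_ne_zero _
  constructor
  · intro h
    constructor
    · intro i
      by_contra hcon
      have := hmem i (by omega)
      rw [h] at this
      have := Multiset.eq_of_mem_replicate this
      omega
    · rw [← hsum, h]
      simp
  · rintro ⟨h1, h2⟩
    have h3 : ∀ b ∈ (univ.val.map a).filter (· ≠ 0), b = 1 := by
      intro b hb
      obtain ⟨hb1, hb2⟩ := Multiset.mem_filter.mp hb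
      obtain ⟨i, -, rfl⟩ := Multiset.mem_map.mp hb1
      have := h1 i
      omega
    rw [Multiset.eq_replicate_card.mpr h3, Multiset.sum_replicate, smul_eq_mul, mul_one, h2] at hsum
    rw [Multiset.eq_replicate_card.mpr h3, hsum]

lemma msymm_eq_esymm {n : ℕ} {mu : n.Partition} (hmu : mu.parts = Multiset.replicate n 1) (N : ℕ) :
    msymm (Fin N) ℝ mu = esymm (Fin N) ℝ n := by
  ext a
  rw [coeff_msymm, coeff_esymm, hmu]
  simp only [filter_eq_replicate_iff]

lemma monomialFun_eq_elemFun {n : ℕ} {mu : n.Partition}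
    (hmu : mu.parts = Multiset.replicate n 1) : monomialFun mu = elemFun n :=
  toVars_injective fun N => by rw [toVars_monomialFun, toVars_elemFun, msymm_eq_esymm hmu]

lemma filter_eq_cons_iff {N n : ℕ} {a : Fin N →₀ ℕ} (hsum : ∑ i, a i = n)
    {i : Fin N} (hi : 2 ≤ a i) :
    (univ.val.map a).filter (· ≠ 0) = 2 ::ₘ Multiset.replicate (n - 2) 1
      ↔ a i = 2 ∧ ∀ j, j ≠ i → a j ≤ 1 := by
  classical
  have h1 : univ.val.map a = a i ::ₘ ((univ.erase i).val.map a) := by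
    rw [← Multiset.map_cons, ← insert_val_of_notMem (notMem_erase i univ),
      insert_erase (mem_univ i)]
  have h2 : ((univ.erase i).val.map a).sum + a i = n := by
    rw [← hsum, ← sum_erase_add _ _ (mem_univ i)]
    rfl
  rw [h1, Multiset.filter_cons_of_pos (p := fun x => x ≠ 0) _ (by omega)]
  set s := (univ.erase i).val.map a with hs
  constructor
  · intro h
    have h3 : a i = 2 := by
      have : a i ∈ 2 ::ₘ Multiset.replicate (n - 2) 1 := by
        rw [← h]
        exact Multiset.mem_cons_self _ _
      rcases Multiset.mem_cons.mp this with h4 | h4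
      · exact h4
      · have := Multiset.eq_of_mem_replicate h4
        omega
    refine ⟨h3, fun j hj => ?_⟩
    rw [h3] at h
    have h4 := (Multiset.cons_inj_right 2).mp h
    by_contra hcon
    have h5 : a j ∈ s.filter (· ≠ 0) := Multiset.mem_filter.mpr
      ⟨Multiset.mem_map_of_mem _ (mem_erase.mpr ⟨hj, mem_univ j⟩), by omega⟩
    rw [h4] at h5
    have := Multiset.eq_of_mem_replicate h5
    omega
  · rintro ⟨h3, h4⟩
    have h5 : ∀ b ∈ s.filter (· ≠ 0), b = 1 := by
      intro b hb
      obtain ⟨hb1, hb2⟩ := Multiset.mem_filter.mp hb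
      obtain ⟨j, hj, rfl⟩ := Multiset.mem_map.mp hb1
      have := h4 j (mem_erase.mp (mem_def.mpr hj)).1
      omega
    have h6 : (s.filter (· ≠ 0)).sum = s.sum := sum_filter_ne_zero _
    rw [Multiset.eq_replicate_card.mpr h5, Multiset.sum_replicate, smul_eq_mul, mul_one] at h6
    rw [h3, Multiset.eq_replicate_card.mpr h5, h6, show s.sum = n - 2 by omega]

/-- A squarefree monomial of degree n arises n times, once for each choice of the factor taken from
p₁; a monomial with one square arises once. -/
lemma esymm_mul_psum_one {n : ℕ} (hn : 2 ≤ n) {lam : n.Partition}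
    (hlam : lam.parts = 2 ::ₘ Multiset.replicate (n - 2) 1) (N : ℕ) :
    esymm (Fin N) ℝ (n - 1) * psum (Fin N) ℝ 1
      = msymm (Fin N) ℝ lam + (n : ℝ) • esymm (Fin N) ℝ n := by
  classical
  ext a
  rw [coeff_mul_psum, coeff_add, coeff_smul, coeff_msymm, hlam, smul_eq_mul]
  simp only [coeff_esymm]
  have h1 : ∀ i, (1 ≤ a i) → ∑ j, (a - Finsupp.single i 1 : Fin N →₀ ℕ) j + 1 = ∑ j, a j := by
    intro i hi
    rw [← sum_erase_add _ _ (mem_univ i), ← sum_erase_add univ a (mem_univ i), add_assoc]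
    congr 1
    · refine sum_congr rfl fun j hj => ?_
      simp [(mem_erase.mp hj).1]
    · simp
      omega
  have h2 : ∀ i, (∀ j, (a - Finsupp.single i 1 : Fin N →₀ ℕ) j ≤ 1)
      ↔ a i ≤ 2 ∧ ∀ j, j ≠ i → a j ≤ 1 := by
    intro i
    constructor
    · intro h
      refine ⟨?_, fun j hj => ?_⟩
      · have := h i
        simp at this
        omega
      · have := h j
        simpa [hj] using this
    · rintro ⟨h3, h4⟩ j
      by_cases hj : j = i
      · subst hj
        simp
        omega
      · simpa [hj] using h4 j hj
  by_cases hsum : ∑ i, a i = n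
  swap
  · rw [if_neg (show ¬((∀ i, a i ≤ 1) ∧ ∑ i, a i = n) from fun h => hsum h.2), if_neg, mul_zero,
      add_zero]
    · refine sum_eq_zero fun i _ => ?_
      split_ifs with h3 h4
      · have := h1 i h3
        omega
      · rfl
      · rfl
    · intro h
      apply hsum
      have h3 : ((univ.val.map a).filter (· ≠ 0)).sum = ∑ i, a i := sum_filter_ne_zero _
      rw [← h3, h, Multiset.sum_cons, Multiset.sum_replicate, smul_eq_mul]
      omega
  by_cases hle : ∀ i, a i ≤ 1
  · rw [if_neg, if_pos (show (∀ i, a i ≤ 1) ∧ ∑ i, a i = n from ⟨hle, hsum⟩), zero_add, mul_one]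
    · have hcast : (n : ℝ) = ∑ i, (a i : ℝ) := by
        rw [← hsum, Nat.cast_sum]
      rw [hcast]
      refine sum_congr rfl fun i _ => ?_
      have h3 := hle i
      by_cases h4 : 1 ≤ a i
      · rw [if_pos h4, if_pos ⟨(h2 i).mpr ⟨by omega, fun j _ => hle j⟩, by have := h1 i h4; omega⟩,
          show a i = 1 by omega, Nat.cast_one]
      · rw [if_neg h4, show a i = 0 by omega, Nat.cast_zero]
    · intro h
      have h3 : 2 ∈ (univ.val.map a).filter (· ≠ 0) := by
        rw [h]
        exact Multiset.mem_cons_self _ _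
      obtain ⟨i, -, hi⟩ := Multiset.mem_map.mp (Multiset.mem_filter.mp h3).1
      have := hle i
      omega
  · rw [if_neg (show ¬((∀ i, a i ≤ 1) ∧ ∑ i, a i = n) from fun h => hle h.1), mul_zero, add_zero]
    push Not at hle
    obtain ⟨i, hi⟩ := hle
    simp only [filter_eq_cons_iff hsum (show 2 ≤ a i by omega)]
    rw [sum_eq_single i]
    · rw [if_pos (by omega)]
      simp only [h2]
      have h3 := h1 i (by omega)
      by_cases h4 : a i = 2 ∧ ∀ j, j ≠ i → a j ≤ 1
      · rw [if_pos h4, if_pos ⟨⟨h4.1.le, h4.2⟩, by omega⟩]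
      · rw [if_neg h4, if_neg]
        rintro ⟨⟨h5, h6⟩, -⟩
        exact h4 ⟨by omega, h6⟩
    · intro j _ hj
      split_ifs with h3 h4
      · have := ((h2 j).mp h4.1).2 i hj.symm
        omega
      · rfl
      · rfl
    · simp

lemma monomialFun_eq_sub {n : ℕ} (hn : 2 ≤ n) {lam : n.Partition}
    (hlam : lam.parts = 2 ::ₘ Multiset.replicate (n - 2) 1) :
    monomialFun lam = X 1 * elemFun (n - 1) - (n : ℝ) • elemFun n :=
  toVars_injective fun N => by
    rw [toVars_monomialFun, map_sub, map_mul, map_smul, toVars_elemFun, toVars_elemFun, toVars_X,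
      PNat.one_coe, mul_comm, esymm_mul_psum_one hn hlam, add_sub_cancel_right]

/-- Expand one factor by the recursion and move p_{n-i} across by adjointness; the derivative lowers
the other factor to the same index i. -/
lemma hall_gfun_neg_one {τ : ℝ} (n : ℕ) : (n : ℝ) * hall τ (gfun (-1) n) (gfun (-1) n)
    = τ⁻¹ * ∑ i ∈ range n, hall τ (gfun (-1) i) (gfun (-1) i) := by
  rw [← hall_smul, natCast_smul_gfun, hall_smul, hall_sum, mul_sum, mul_sum]
  refine sum_congr rfl fun i hi => ?_
  have hi' := mem_range.mp hi
  rw [hall_X_mul, pderiv_gfun, Nat.succPNat_coe, show (n - 1 - i).succ = n - i by omega,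
    if_pos (by omega), hall_smul_left, show n - (n - i) = i by omega]
  have : ((n - i : ℕ) : ℝ) ≠ 0 := by
    have : 0 < n - i := by omega
    positivity
  field_simp

lemma hall_elemFun (τ : ℝ) (n : ℕ) :
    hall τ (elemFun n) (elemFun n) = hall τ (gfun (-1) n) (gfun (-1) n) := by
  rw [elemFun, hall_smul, hall_smul_left, ← mul_assoc, ← mul_pow]
  simp

/-- Subtract the norm recursions `hall_gfun_neg_one` for n + 1 and n. -/
lemma hall_elemFun_succ {τ : ℝ} (hτ : 0 < τ) (n : ℕ) :
    (1 + n * τ) * hall τ (elemFun n) (elemFun n)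
      = (n + 1) * τ * hall τ (elemFun (n + 1)) (elemFun (n + 1)) := by
  rw [hall_elemFun, hall_elemFun]
  have h1 := hall_gfun_neg_one (τ := τ) n
  have h2 := hall_gfun_neg_one (τ := τ) (n + 1)
  rw [sum_range_succ, mul_add, ← h1] at h2
  push_cast at h2
  have h3 : τ * τ⁻¹ = 1 := mul_inv_cancel₀ hτ.ne'
  linear_combination (-τ) * h2 - hall τ (gfun (-1) n) (gfun (-1) n) * h3

lemma hall_X_mul_elemFun {τ : ℝ} (n : ℕ) : hall τ (elemFun (n + 1)) (X 1 * elemFun n)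
    = τ⁻¹ * hall τ (elemFun n) (elemFun n) := by
  rw [hall_X_mul, elemFun, Derivation.map_smul, pderiv_gfun, if_pos (by simp), PNat.one_coe,
    Nat.add_sub_cancel, hall_smul_left, hall_smul_left, elemFun, hall_smul_left, pow_succ]
  push_cast
  ring

end Jack

end

noncomputable section

namespace Jack

open MvPolynomial Filter

/-! ### The two lowest Jack polynomials -/

lemma Majorizes.refl {d : ℕ} (lam : d.Partition) : Majorizes lam lam := fun _ => le_rfl

/-! ### The dominance order below (2, 1^{n-2}) -/

lemma eq_replicate_of_top_le_one {n : ℕ} {mu : n.Partition} (h : top mu ≤ 1) :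
    mu.parts = Multiset.replicate n 1 := by
  have h1 : ∀ b ∈ mu.parts, b = 1 := by
    intro b hb
    have h2 := mu.parts_pos hb
    rcases top_cases mu with ⟨h3, -, -⟩ | ⟨t, h3, h4, -, -⟩
    · rw [h3] at hb
      simp at hb
    · rw [h3] at hb
      rcases Multiset.mem_cons.mp hb with h5 | h5
      · omega
      · have := h4 b (by simpa using h5)
        omega
  have h2 := mu.parts_sum
  rw [Multiset.eq_replicate_card.mpr h1, Multiset.sum_replicate, smul_eq_mul, mul_one] at h2
  rw [Multiset.eq_replicate_card.mpr h1, h2]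

lemma sort_replicate_one (n : ℕ) :
    (Multiset.replicate n 1).sort (· ≥ ·) = List.replicate n 1 := by
  rw [List.eq_replicate_iff]
  refine ⟨by rw [Multiset.length_sort, Multiset.card_replicate], fun b hb => ?_⟩
  exact Multiset.eq_of_mem_replicate ((Multiset.mem_sort (r := (· ≥ ·))).mp hb)

lemma partialSum_replicate {n : ℕ} {mu : n.Partition} (hmu : mu.parts = Multiset.replicate n 1)
    (k : ℕ) : partialSum mu k = min k n := by
  rw [partialSum, hmu, sort_replicate_one, List.take_replicate, List.sum_replicate, smul_eq_mul,
    mul_one]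

lemma sort_cons_replicate_one (n : ℕ) :
    (2 ::ₘ Multiset.replicate n 1).sort (· ≥ ·) = 2 :: List.replicate n 1 := by
  rw [Multiset.sort_cons, sort_replicate_one]
  intro b hb
  have := Multiset.eq_of_mem_replicate hb
  omega

lemma partialSum_cons_replicate {n : ℕ} {lam : n.Partition}
    (hlam : lam.parts = 2 ::ₘ Multiset.replicate (n - 2) 1) (k : ℕ) :
    partialSum lam (k + 1) = 2 + min k (n - 2) := by
  rw [partialSum, hlam, sort_cons_replicate_one, List.take_succ_cons, List.take_replicate,
    List.sum_cons, List.sum_replicate, smul_eq_mul, mul_one]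

lemma eq_of_majorizes_replicate {n : ℕ} {mu nu : n.Partition}
    (hmu : mu.parts = Multiset.replicate n 1) (h : Majorizes mu nu) : nu = mu := by
  have h1 := h 1
  rw [partialSum_replicate hmu] at h1
  ext1
  rw [eq_replicate_of_top_le_one (h1.trans (min_le_left _ _)), hmu]

lemma majorizes_cons_replicate {n : ℕ} {lam mu : n.Partition}
    (hlam : lam.parts = 2 ::ₘ Multiset.replicate (n - 2) 1)
    (hmu : mu.parts = Multiset.replicate n 1) : Majorizes lam mu := by
  intro k
  rw [partialSum_replicate hmu]
  cases k with
  | zero => simp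
  | succ k =>
    rw [partialSum_cons_replicate hlam]
    omega

/-- The first two partial sums are at most 2 and 3. A largest part 2 therefore leaves only ones
after it, and a largest part at most 1 leaves only 1^n. -/
lemma eq_of_majorizes_cons_replicate {n : ℕ} {lam mu nu : n.Partition}
    (hlam : lam.parts = 2 ::ₘ Multiset.replicate (n - 2) 1)
    (hmu : mu.parts = Multiset.replicate n 1) (h : Majorizes lam nu) (hne : nu ≠ lam) :
    nu = mu := by
  have h1 := h 1
  have h2 := h 2
  rw [partialSum_cons_replicate hlam] at h1 h2
  have h1' : top nu ≤ 2 := by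
    refine h1.trans ?_
    simp
  have h2' : partialSum nu 2 ≤ 3 := by omega
  ext1
  rw [hmu]
  refine eq_replicate_of_top_le_one ?_
  by_contra hcon
  have htop : top nu = 2 := by omega
  apply hne
  rcases top_cases nu with ⟨-, h3, -⟩ | ⟨t, h3, -, h5, h6⟩
  · omega
  have hsorted := Multiset.pairwise_sort nu.parts (· ≥ ·)
  rw [h6] at hsorted
  rw [partialSum, h6, htop] at h2'
  have hone : ∀ b ∈ t, b = 1 := by
    intro b hb
    have hpos : 0 < b := nu.parts_pos (by rw [h3]; simp [hb])
    match t, hb, h2', hsorted with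
    | c :: t, hb, h2', hsorted =>
      simp only [List.take_succ_cons, List.take_zero, List.sum_cons, List.sum_nil] at h2'
      rcases List.mem_cons.mp hb with h7 | h7
      · omega
      · have := (List.pairwise_cons.mp (List.pairwise_cons.mp hsorted).2).1 b h7
        omega
  have ht : t = List.replicate (n - 2) 1 := by
    have h7 := List.eq_replicate_of_mem hone
    rw [h7, List.sum_replicate, smul_eq_mul, mul_one] at h5
    rw [h7, show t.length = n - 2 by omega]
  ext1
  rw [h3, hlam, htop, ht, Multiset.coe_replicate]

/-- The coefficient of `m_{1^n}` in the Jack polynomial of `(2, 1^{n-2})`, with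
`θ = 1 / (1 + τ)`. -/
def lowCoeff (n : ℕ) (θ : ℝ) : ℝ := n * (n - 1) * (1 - θ) / (θ + (n - 1) * (1 - θ))

lemma lowCoeff_denom_pos {n : ℕ} (hn : 2 ≤ n) {θ : ℝ} (h1 : θ ≤ 1) :
    0 < θ + ((n : ℝ) - 1) * (1 - θ) := by
  have : (2 : ℝ) ≤ n := by exact_mod_cast hn
  nlinarith

lemma lowCoeff_nonneg {n : ℕ} (hn : 2 ≤ n) {θ : ℝ} (h1 : θ ≤ 1) : 0 ≤ lowCoeff n θ := by
  have h2 : (2 : ℝ) ≤ n := by exact_mod_cast hn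
  refine div_nonneg (mul_nonneg (mul_nonneg ?_ ?_) ?_) (lowCoeff_denom_pos hn h1).le <;> linarith

/-- The single orthogonality condition on P_λ. Writing m_λ = p₁ e_{n-1} - n e_n reduces it to the
ratio of the norms of e_{n-1} and e_n, which gives the coefficient n(n-1)τ / (1 + (n-1)τ). -/
lemma lowCoeff_hall {n : ℕ} (hn : 2 ≤ n) {t : ℝ} (ht : 0 < t) {lam : n.Partition}
    (hlam : lam.parts = 2 ::ₘ Multiset.replicate (n - 2) 1) :
    hall t (elemFun n) (monomialFun lam)
      + lowCoeff n (1 + t)⁻¹ * hall t (elemFun n) (elemFun n) = 0 := by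
  rw [monomialFun_eq_sub hn hlam]
  obtain ⟨n, rfl⟩ : ∃ m, n = m + 1 := ⟨n - 1, by omega⟩
  rw [Nat.add_sub_cancel, hall_sub, hall_X_mul_elemFun, hall_smul]
  have h1 := hall_elemFun_succ ht n
  have hc : lowCoeff (n + 1) (1 + t)⁻¹ = (n + 1) * n * t / (1 + n * t) := by
    rw [lowCoeff]
    push_cast
    have e1 : 1 - (1 + t)⁻¹ = t * (1 + t)⁻¹ := by
      field_simp
      ring
    have e2 : (1 + t)⁻¹ + ((n : ℝ) + 1 - 1) * (t * (1 + t)⁻¹) = (1 + n * t) * (1 + t)⁻¹ := by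
      ring
    rw [e1, e2]
    field_simp
    ring
  rw [hc]
  set G := hall t (elemFun n) (elemFun n)
  set G' := hall t (elemFun (n + 1)) (elemFun (n + 1))
  have h2 : (1 + (n : ℝ) * t) ≠ 0 := by positivity
  have h3 : G = (n + 1) * t * G' / (1 + n * t) := by
    rw [eq_div_iff h2]
    linarith
  rw [h3]
  push_cast
  field_simp
  ring

open Classical in
lemma isJackExpansion_low {n : ℕ} (hn : 2 ≤ n) {t : ℝ} (ht : 0 < t) {lam mu : n.Partition}
    (hlam : lam.parts = 2 ::ₘ Multiset.replicate (n - 2) 1)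
    (hmu : mu.parts = Multiset.replicate n 1) : IsJackExpansion t lam
      (fun nu => if nu = lam then 1 else if nu = mu then lowCoeff n (1 + t)⁻¹ else 0) := by
  have hne : mu ≠ lam := by
    rintro rfl
    have h1 : 2 ∈ mu.parts := by
      rw [hlam]
      exact Multiset.mem_cons_self _ _
    rw [hmu] at h1
    have := Multiset.eq_of_mem_replicate h1
    omega
  refine ⟨if_pos rfl, fun nu hnu => ?_, fun nu hmaj hnu => ?_⟩
  · by_cases h1 : nu = lam
    · rw [h1]
      exact Majorizes.refl lam
    · by_cases h2 : nu = mu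
      · rw [h2]
        exact majorizes_cons_replicate hlam hmu
      · exact absurd ((if_neg h1).trans (if_neg h2)) hnu
  · obtain rfl := eq_of_majorizes_cons_replicate hlam hmu hmaj hnu
    rw [hall_comm, hall_sum, Finset.sum_eq_add lam nu hne.symm]
    · beta_reduce
      rw [hall_smul, hall_smul, if_pos rfl, if_neg hne, if_pos rfl, one_mul,
        monomialFun_eq_elemFun hmu]
      exact lowCoeff_hall hn ht hlam
    · rintro rho - ⟨h1, h2⟩
      beta_reduce
      rw [hall_smul, if_neg h1, if_neg h2, zero_mul]
    · simp
    · simp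

open Classical in
lemma isJackExpansion_lowest {n : ℕ} (t : ℝ) {mu : n.Partition}
    (hmu : mu.parts = Multiset.replicate n 1) :
    IsJackExpansion t mu (fun nu => if nu = mu then 1 else 0) := by
  refine ⟨if_pos rfl, fun nu hnu => ?_, fun nu hmaj hnu => ?_⟩
  · by_cases h1 : nu = mu
    · rw [h1]
      exact Majorizes.refl mu
    · exact absurd (if_neg h1) hnu
  · exact absurd (eq_of_majorizes_replicate hmu hmaj) hnu

/-! ### The lowest two Jack polynomials for all τ ∈ [0, ∞], and their difference -/

lemma jackPoly_low {n : ℕ} (hn : 2 ≤ n) (N : ℕ) (τ : ℝ≥0∞) {lam mu : n.Partition}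
    (hlam : lam.parts = 2 ::ₘ Multiset.replicate (n - 2) 1)
    (hmu : mu.parts = Multiset.replicate n 1) : jackPoly N lam τ
      = msymm (Fin N) ℝ lam + lowCoeff n (theta τ) • msymm (Fin N) ℝ mu := by
  classical
  obtain ⟨l, hl, hpos, htheta, hlim⟩ := exists_filter τ
  have hne : lam ≠ mu := by
    rintro rfl
    have h1 : 2 ∈ lam.parts := by
      rw [hlam]
      exact Multiset.mem_cons_self _ _
    rw [hmu] at h1
    have := Multiset.eq_of_mem_replicate h1
    omega
  have hc : Tendsto (fun t : ℝ => lowCoeff n (1 + t)⁻¹) l (𝓝 (lowCoeff n (theta τ))) := by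
    have h1 : ContinuousAt (lowCoeff n) (theta τ) := by
      unfold lowCoeff
      exact ContinuousAt.div (by fun_prop) (by fun_prop)
        (lowCoeff_denom_pos hn (theta_le_one τ)).ne'
    exact h1.tendsto.comp htheta
  have hK : ∀ nu, jackCoeff lam nu τ
      = if nu = lam then 1 else if nu = mu then lowCoeff n (theta τ) else 0 := by
    intro nu
    apply hlim
    have h1 : Tendsto (fun t : ℝ => if nu = lam then 1 else
        if nu = mu then lowCoeff n (1 + t)⁻¹ else 0) l
        (𝓝 (if nu = lam then 1 else if nu = mu then lowCoeff n (theta τ) else 0)) := by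
      split_ifs
      · exact tendsto_const_nhds
      · exact hc
      · exact tendsto_const_nhds
    refine h1.congr' ?_
    filter_upwards [hpos] with t ht
    rw [jackCoeffReal_eq ht (isJackExpansion_low hn ht hlam hmu)]
  rw [jackPoly, Finset.sum_eq_add lam mu hne]
  · rw [hK, hK, if_pos rfl, if_neg hne.symm, if_pos rfl, one_smul]
  · rintro nu - ⟨h1, h2⟩
    rw [hK, if_neg h1, if_neg h2, zero_smul]
  · simp
  · simp

lemma jackPoly_lowest {n : ℕ} (N : ℕ) (τ : ℝ≥0∞) {mu : n.Partition}
    (hmu : mu.parts = Multiset.replicate n 1) : jackPoly N mu τ = msymm (Fin N) ℝ mu := by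
  classical
  obtain ⟨l, hl, hpos, -, hlim⟩ := exists_filter τ
  have hK : ∀ nu, jackCoeff mu nu τ = if nu = mu then 1 else 0 := by
    intro nu
    apply hlim
    refine tendsto_const_nhds.congr' ?_
    filter_upwards [hpos] with t ht
    rw [jackCoeffReal_eq ht (isJackExpansion_lowest t hmu)]
  rw [jackPoly, Finset.sum_eq_single mu]
  · rw [hK, if_pos rfl, one_smul]
  · intro nu _ h
    rw [hK, if_neg h, zero_smul]
  · simp

lemma eval_one_esymm (N k : ℕ) :
    eval (fun _ => (1 : ℝ)) (esymm (Fin N) ℝ k) = N.choose k := by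
  rw [esymm, map_sum]
  simp [map_prod]

/-- The parameter enters only through the positive scalar, so all these differences lie on one ray.
-/
lemma jackDiff_low {n : ℕ} (hn : 2 ≤ n) (τ : ℝ≥0∞) {lam mu : n.Partition}
    (hlam : lam.parts = 2 ::ₘ Multiset.replicate (n - 2) 1)
    (hmu : mu.parts = Multiset.replicate n 1) : jackDiff n lam mu τ
      = (n * (n - 1) + lowCoeff n (theta τ))⁻¹ •
        (msymm (Fin n) ℝ lam - ((n : ℝ) * (n - 1)) • msymm (Fin n) ℝ mu) := by
  have h1 : eval (fun _ => (1 : ℝ)) (msymm (Fin n) ℝ mu) = 1 := by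
    rw [msymm_eq_esymm hmu, eval_one_esymm, Nat.choose_self, Nat.cast_one]
  have h2 : eval (fun _ => (1 : ℝ)) (msymm (Fin n) ℝ lam) = n * (n - 1) := by
    have h := congrArg (eval (fun _ => (1 : ℝ))) (esymm_mul_psum_one hn hlam n)
    rw [map_mul, map_add, smul_eval, eval_one_esymm, eval_one_esymm, psum, map_sum,
      Nat.choose_self, Nat.choose_symm (by omega : 1 ≤ n), Nat.choose_one_right] at h
    simp at h
    linarith
  have h3 := lowCoeff_nonneg hn (theta_le_one τ)
  have h4 : (2 : ℝ) ≤ n := by exact_mod_cast hn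
  have h5 : (n : ℝ) * (n - 1) + lowCoeff n (theta τ) ≠ 0 := by nlinarith
  rw [jackDiff, normJack, normJack, jackPoly_low hn n τ hlam hmu, jackPoly_lowest n τ hmu, map_add,
    smul_eval, h1, h2, inv_one, one_smul, mul_one]
  set A := msymm (Fin n) ℝ lam
  set B := msymm (Fin n) ℝ mu
  set c := lowCoeff n (theta τ)
  have h6 : B = ((n : ℝ) * (n - 1) + c)⁻¹ • (((n : ℝ) * (n - 1) + c) • B) := by
    rw [smul_smul, inv_mul_cancel₀ h5, one_smul]
  conv_lhs => rw [sub_eq_add_neg]; rhs; rw [h6]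
  rw [← sub_eq_add_neg, ← smul_sub, add_smul]
  congr 1
  abel

theorem jackDiff_low_mem {n : ℕ} (hn : 2 ≤ n) (σ τ : ℝ≥0∞) {lam mu : n.Partition}
    (hlam : lam.parts = 2 ::ₘ Multiset.replicate (n - 2) 1)
    (hmu : mu.parts = Multiset.replicate n 1) : jackDiff n lam mu τ ∈ jackCone n σ := by
  have hmem : jackDiff n lam mu σ ∈ jackCone n σ := by
    refine jackDiff_mem_jackCone σ ?_ ?_ (majorizes_cons_replicate hlam hmu)
    · rw [hlam, Multiset.card_cons, Multiset.card_replicate]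
      omega
    · rw [hmu, Multiset.card_replicate]
  have h4 : (2 : ℝ) ≤ n := by exact_mod_cast hn
  have hpos : ∀ ρ : ℝ≥0∞, 0 < (n : ℝ) * (n - 1) + lowCoeff n (theta ρ) := fun ρ => by
    have h3 := lowCoeff_nonneg hn (theta_le_one ρ)
    nlinarith
  have h5 := smul_mem_jackCone (mul_nonneg (inv_nonneg.mpr (hpos τ).le) (hpos σ).le) hmem
  rw [jackDiff_low hn σ hlam hmu, smul_smul, mul_assoc, mul_inv_cancel₀ (hpos σ).ne', mul_one] at h5
  rwa [jackDiff_low hn τ hlam hmu]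

end Jack

end

theorem mainTheorem6 :
    (∀ (σ τ : ℝ≥0∞), σ ≤ τ → ∀ (d : ℕ) (lam mu : d.Partition),
      lam.parts.card ≤ 2 → mu.parts.card ≤ 2 → Jack.Majorizes lam mu →
        Jack.jackDiff 2 lam mu τ ∈ Jack.jackCone 2 σ) ∧
    (∀ (σ τ : ℝ≥0∞), σ ≤ τ → ∀ (n : ℕ), 3 ≤ n → ∀ (lam mu : n.Partition),
      lam.parts = 2 ::ₘ Multiset.replicate (n - 2) 1 → mu.parts = Multiset.replicate n 1 →
        Jack.jackDiff n lam mu τ ∈ Jack.jackCone n σ) :=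
  ⟨fun _ _ h _ _ _ h1 h2 h3 => Jack.jackDiff_two_mem h h1 h2 h3,
    fun σ τ _ _ hn _ _ h1 h2 => Jack.jackDiff_low_mem (by omega) σ τ h1 h2⟩
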